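/- **Setting.** A job of $k\ge 1$ tasks is launched at time $0$. All task execution times are i.i.d. copies of a random variable. *Replication.* Each task is launched in $c+1$ copies ($c\ge 0$ replicas are added). A task completes when its fastest copy completes, at which moment its other copies are canceled; the job completes when all $k$ tasks have completed. *Coding.* $n\ge k$ tasks are launched ($n-k$ of them MDS-coded). The job completes as soon as any $k$ of the $n$ tasks have completed, at which moment the remaining ones are canceled. The latency is the completion time of the job and the cost is the sum, over all launched tasks and copies, of the time from launch to completion or cancellation. Write $T_c, C_c$ for latency and cost under replication and $T_n, C_n$ under coding. **Notation.** $\mathrm{Exp}(\mu)$ has rate $\mu>0$; $\mathrm{SExp}(s,\mu)$ is the law of $s+E$ with $E\sim\mathrm{Exp}(\mu)$, $s>0$; $\mathrm{Pareto}(s,\alpha)$ has $\Pr\{X>x\}=(s/x)^\alpha$ for $x\ge s>0$, with $\alpha>0$. $X_{n:i}$ is the $i$-th smallest of $n$ i.i.d. samples of $X$; $H_n=\sum_{m=1}^n 1/m$ and $H_{n^2}=\sum_{m=1}^n 1/m^2$ (both are $0$ for $n=0$; in $H_{(n-i)^2}$ the number of terms is $n-i$). **Theorem.** 1. Let $X\sim\mathrm{Exp}(\mu)$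 and $1\le i\le j\le n$. Then $X_{n:i}X_{n:j}$ is integrable and $$\mathbb E[X_{n:i}X_{n:j}]=\frac1{\mu^2}\Bigl(H_{n^2}-H_{(n-i)^2}+(H_n-H_{n-i})(H_n-H_{n-j})\Bigr).$$ 2. Let the task execution times be i.i.d. $\mathrm{SExp}(s,\mu)$, and let $X\sim\mathrm{Exp}(\mu)$ and $Y\sim\mathrm{Exp}((c+1)\mu)$. Then $T_c, C_c, T_n, C_n$ have finite second moments, given by $$\mathbb E[T_c^2]=\Bigl(s+\frac{H_k}{(c+1)\mu}\Bigr)^2+\frac{H_{k^2}}{(c+1)^2\mu^2},$$ $$\mathbb E[C_c^2]=(k(c+1)s)^2+2k(c+1)s\,\frac k\mu+(c+1)^2\sum_{i,j=1}^k\mathbb E[Y_{k:i}Y_{k:j}],$$ $$\mathbb E[T_n^2]=\frac{H_{n^2}-H_{(n-k)^2}}{\mu^2}+\Bigl(s+\frac{H_n-H_{n-k}}{\mu}\Bigr)^2,$$ $$\mathbb E[C_n^2]=(ns)^2+2ns\,\frac k\mu+(n-k)^2\,\mathbb E[X_{n:k}^2]+2(n-k)\sum_{i=1}^k\mathbb E[X_{n:i}X_{n:k}]+\sum_{i,j=1}^k\mathbb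 E[X_{n:i}X_{n:j}].$$ 3. Let $X\sim\mathrm{Pareto}(s,\alpha)$, $1\le i\le j\le n$ and $\alpha>\max\{2/(n-i+1),\,1/(n-j+1)\}$. Then $X_{n:i}X_{n:j}$ is integrable and $$\mathbb E[X_{n:i}X_{n:j}]=s^2\,\frac{n!}{\Gamma(n+1-2/\alpha)}\;\frac{\Gamma(n-i+1-2/\alpha)}{\Gamma(n-i+1-1/\alpha)}\;\frac{\Gamma(n-j+1-1/\alpha)}{\Gamma(n-j+1)}.$$ 4. Let the task execution times be i.i.d. $\mathrm{Pareto}(s,\alpha)$, and let $X\sim\mathrm{Pareto}(s,\alpha)$ and $Y\sim\mathrm{Pareto}(s,(c+1)\alpha)$. Then $$\mathbb E[T_c^2]=\mathbb E[Y_{k:k}^2],\qquad \mathbb E[C_c^2]=(c+1)^2\sum_{i,j=1}^k\mathbb E[Y_{k:i}Y_{k:j}],\qquad \mathbb E[T_n^2]=\mathbb E[X_{n:k}^2],$$ $$\mathbb E[C_n^2]=(n-k)^2\,\mathbb E[X_{n:k}^2]+2(n-k)\sum_{i=1}^k\mathbb E[X_{n:i}X_{n:k}]+\sum_{i,j=1}^k\mathbb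 E[X_{n:i}X_{n:j}],$$ as identities in $[0,\infty]$ (with $0\cdot\infty=0$). Moreover $T_c$ and $C_c$ have finite second moments when $(c+1)\alpha>2$, and $T_n$ and $C_n$ have finite second moments when $(n-k+1)\alpha>2$; the identities are then between finite real numbers. -/

import Mathlib

open MeasureTheory ProbabilityTheory
open scoped ENNReal

noncomputable section

namespace Straggler

/-- Generalized harmonic number of order two, `H_{n^2} = ∑_{m=1}^n 1/m^2`. -/
def harmonicTwo (n : ℕ) : ℝ := ∑ m ∈ Finset.Icc 1 n, 1 / (m : ℝ) ^ 2

/-- The shifted exponential law `SExp(s, μ)`: the law of `s + E` with `E ∼ Exp(μ)`. -/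
def sexpMeasure (s μ : ℝ) : Measure ℝ := (expMeasure μ).map (fun x => s + x)

/-- The `i`-th smallest value `x_{n:i}` of `x_1, …, x_n`, for `1 ≤ i ≤ n`
(the index is one-based; the value outside of this range is irrelevant). -/
def orderStat {n : ℕ} (x : Fin n → ℝ) (i : ℕ) : ℝ :=
  if h : 1 ≤ i ∧ i ≤ n then x (Tuple.sort x ⟨i - 1, by omega⟩) else 0

/-- The law of `n` i.i.d. samples from `ν`. -/
def sampleMeasure (ν : Measure ℝ) (n : ℕ) : Measure (Fin n → ℝ) := Measure.pi (fun _ => ν)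

/-- `E[X_{n:i} X_{n:j}]` for `n` i.i.d. samples with law `ν`. -/
def jointMoment (ν : Measure ℝ) (n i j : ℕ) : ℝ :=
  ∫ x, orderStat x i * orderStat x j ∂(sampleMeasure ν n)

/-- `E[X_{n:i} X_{n:j}]` as an element of `[0, ∞]`, for a law `ν` on the positive half-line. -/
def jointMomentE (ν : Measure ℝ) (n i j : ℕ) : ℝ≥0∞ :=
  ∫⁻ x, ENNReal.ofReal (orderStat x i * orderStat x j) ∂(sampleMeasure ν n)

/-- The family `X` is i.i.d. with common law `ν`. -/
def IsIID {Ω ι : Type*} [MeasurableSpace Ω] (X : ι → Ω → ℝ) (ν : Measure ℝ)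
    (P : Measure Ω) : Prop :=
  iIndepFun X P ∧ ∀ i, HasLaw (X i) ν P

/-! Replication: `k` tasks, each launched at time `0` in `c + 1` copies; `x (a, b)` is the
execution time of copy `b` of task `a`. -/

/-- Task `a` completes as soon as its fastest copy completes. -/
def repTaskTime {k c : ℕ} (x : Fin k × Fin (c + 1) → ℝ) (a : Fin k) : ℝ :=
  ⨅ b : Fin (c + 1), x (a, b)

/-- The job completes when all its tasks have completed. -/
def repLatency {k c : ℕ} (x : Fin k × Fin (c + 1) → ℝ) : ℝ :=
  ⨆ a : Fin k, repTaskTime x a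

/-- The sum of the lifetimes of all `k (c + 1)` copies; a copy lives until it completes or is
canceled, which happens when its task completes. -/
def repCost {k c : ℕ} (x : Fin k × Fin (c + 1) → ℝ) : ℝ :=
  ∑ p : Fin k × Fin (c + 1), min (x p) (repTaskTime x p.1)

/-! Coding: `n` tasks (`k` initial ones and `n - k` MDS-coded ones) are launched at time `0`;
`x l` is the execution time of task `l`. -/

/-- The job completes as soon as any `k` of the `n` tasks have completed. -/
def codLatency (k : ℕ) {n : ℕ} (x : Fin n → ℝ) : ℝ := orderStat x k

/-- The sum of the lifetimes of all `n` tasks; a task lives until it completes or is canceled,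
which happens when the job completes. -/
def codCost (k : ℕ) {n : ℕ} (x : Fin n → ℝ) : ℝ :=
  ∑ l : Fin n, min (x l) (codLatency k x)

/-- `Z` has a finite second moment, with value `m`. -/
def HasSecondMoment {Ω : Type*} [MeasurableSpace Ω] (Z : Ω → ℝ) (P : Measure Ω) (m : ℝ) : Prop :=
  Integrable (fun ω => Z ω ^ 2) P ∧ ∫ ω, Z ω ^ 2 ∂P = m

/-- `Z` is almost everywhere measurable, with second moment `m` in `[0, ∞]`. -/
def HasSecondMomentE {Ω : Type*} [MeasurableSpace Ω] (Z : Ω → ℝ) (P : Measure Ω)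
    (m : ℝ≥0∞) : Prop :=
  AEMeasurable Z P ∧ ∫⁻ ω, ENNReal.ofReal (Z ω ^ 2) ∂P = m

end Straggler

end

namespace Straggler

/-! Everything reduces to products of two order statistics of one i.i.d. sample. Under coding, the
first `k` tasks to finish run to completion and the other `n - k` stop at the `k`-th completion, so
the cost is linear in the order statistics (`codCost_eq`). Under replication, all copies of a task
live until the fastest one ends, so latency and cost are those of uncoded tasks (`n = k`) whose
times are minima of `c + 1` copies, the cost being multiplied by `c + 1` (`repCost_eq`). These
minima stay in the same family, with rate or tail index multiplied by `c + 1`. Squaring and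
integrating leaves only joint moments.

For exponential samples these come from Rényi's recursion (`map_orderStat_succ`): the minimum `M` of
`n + 1` samples is exponential of rate `(n + 1) r`, and by memorylessness the excesses over `M` are
an independent sample of size `n`. Hence order statistics `i + 1` and `j + 1` are jointly
distributed as `M` plus order statistics `i` and `j` of the smaller sample, with index `0` read as
the value `0`. Each step preserves `n - i` and `n - j`, so induction adds terms to harmonic sums.

A Pareto variable is `s * exp E` with `E` exponential, and increasing maps commute with order
statistics. Pareto products are thus exponential moments; each recursion step multiplies them by a
factor absorbed by `Γ (x + 1) = x Γ x`. -/

/-! ### Order statistics and the cost functionals, pointwise -/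

/-- With ties the sorting permutation is not unique, but the sorted tuple is; any convenient
permutation may therefore be used. -/
lemma orderStat_eq_of_monotone {n : ℕ} {x : Fin n → ℝ} {σ : Equiv.Perm (Fin n)}
    (h : Monotone (x ∘ σ)) {i : ℕ} (hi : 1 ≤ i ∧ i ≤ n) :
    orderStat x i = x (σ ⟨i - 1, by omega⟩) := by
  rw [orderStat, dif_pos hi]
  exact (congrFun (Tuple.comp_sort_eq_comp_iff_monotone.2 h) _).symm

lemma orderStat_eq {n : ℕ} (x : Fin n → ℝ) {i : ℕ} (hi : 1 ≤ i ∧ i ≤ n) :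
    orderStat x i = x (Tuple.sort x ⟨i - 1, by omega⟩) := by
  rw [orderStat, dif_pos hi]

-- The default value at index `0` acts as the convention that starts the recursions below.
@[simp]
lemma orderStat_zero {n : ℕ} (x : Fin n → ℝ) : orderStat x 0 = 0 := by
  simp [orderStat]

lemma orderStat_comp_perm {n : ℕ} (x : Fin n → ℝ) (σ : Equiv.Perm (Fin n)) (i : ℕ) :
    orderStat (x ∘ σ) i = orderStat x i := by
  by_cases hi : 1 ≤ i ∧ i ≤ n
  · rw [orderStat_eq _ hi, orderStat_eq _ hi]
    exact congrFun (Tuple.comp_perm_comp_sort_eq_comp_sort (f := x) (σ := σ)) _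
  · simp only [orderStat, dif_neg hi]

lemma orderStat_map {n : ℕ} (x : Fin n → ℝ) {φ : ℝ → ℝ} (hφ : Monotone φ) {i : ℕ}
    (hi : 1 ≤ i ∧ i ≤ n) : orderStat (fun l => φ (x l)) i = φ (orderStat x i) := by
  rw [orderStat_eq x hi, orderStat_eq_of_monotone (σ := Tuple.sort x) _ hi]
  exact hφ.comp (Tuple.monotone_sort x)

lemma orderStat_mono {n : ℕ} (x : Fin n → ℝ) {i j : ℕ} (hi : 1 ≤ i) (hij : i ≤ j) (hj : j ≤ n) :
    orderStat x i ≤ orderStat x j := by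
  rw [orderStat_eq x ⟨hi, hij.trans hj⟩, orderStat_eq x ⟨hi.trans hij, hj⟩]
  exact Tuple.monotone_sort x (Fin.mk_le_mk.2 (by omega))

lemma orderStat_nonneg {n : ℕ} {x : Fin n → ℝ} (hx : ∀ l, 0 ≤ x l) (i : ℕ) :
    0 ≤ orderStat x i := by
  unfold orderStat
  split_ifs
  · exact hx _
  · exact le_rfl

/-- A lower bound put in front shifts every rank by one. Rank one is separate, since `orderStat y 0`
is the default `0` rather than `m`. -/
lemma orderStat_cons {n : ℕ} (m : ℝ) (y : Fin n → ℝ) (h : ∀ l, m ≤ y l) {i : ℕ} (hi : i ≤ n) :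
    orderStat (Fin.cons m y : Fin (n + 1) → ℝ) (i + 1) = if i = 0 then m else orderStat y i := by
  -- This permutation fixes `0` and sorts the tail.
  set σ : Equiv.Perm (Fin (n + 1)) := Equiv.Perm.decomposeFin.symm (0, Tuple.sort y) with hσ
  have h0 : σ 0 = 0 := by simp [hσ]
  have hs : ∀ l : Fin n, σ l.succ = (Tuple.sort y l).succ := fun l => by
    simp [hσ]
  have hm : Monotone ((Fin.cons m y : Fin (n + 1) → ℝ) ∘ σ) := by
    intro a b hab
    induction a using Fin.cases with
    | zero =>
      induction b using Fin.cases with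
      | zero => exact le_rfl
      | succ b => simpa [h0, hs] using h _
    | succ a =>
      induction b using Fin.cases with
      | zero => simp at hab
      | succ b =>
        simp only [Function.comp_apply, hs, Fin.cons_succ]
        exact Tuple.monotone_sort y (Fin.succ_le_succ_iff.1 hab)
  rw [orderStat_eq_of_monotone hm ⟨by omega, by omega⟩]
  rcases i with _ | i
  · have : (⟨0 + 1 - 1, by omega⟩ : Fin (n + 1)) = 0 := rfl
    rw [this, h0]; simp
  · have : (⟨i + 1 + 1 - 1, by omega⟩ : Fin (n + 1)) = Fin.succ ⟨i, by omega⟩ := rfl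
    rw [this, hs, if_neg (by omega), orderStat_eq y ⟨by omega, hi⟩]
    simp

lemma sum_Icc_orderStat {n : ℕ} (x : Fin n → ℝ) (f : ℝ → ℝ) :
    ∑ i ∈ Finset.Icc 1 n, f (orderStat x i) = ∑ l, f (x l) := by
  rw [← Equiv.sum_comp (Tuple.sort x)]
  refine Finset.sum_bij' (fun i hi => ⟨i - 1, by simp at hi; omega⟩) (fun l _ => l + 1)
    (by simp) (fun l _ => by simp) (fun i hi => by simp at hi ⊢; omega) (by simp) ?_
  intro i hi
  rw [orderStat_eq x (by simpa using hi)]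

/-- After sorting, the minimum with the latency is inactive up to rank `k` and equals the latency
beyond it. -/
lemma codCost_eq {k n : ℕ} (hk : 1 ≤ k) (hkn : k ≤ n) (x : Fin n → ℝ) :
    codCost k x = ∑ i ∈ Finset.Icc 1 k, orderStat x i + ((n : ℝ) - k) * orderStat x k := by
  rw [codCost, ← sum_Icc_orderStat x (fun t => min t (codLatency k x)), codLatency]
  have hsplit : Finset.Icc 1 n = Finset.Icc 1 k ∪ Finset.Ioc k n := by
    ext; simp; omega
  rw [hsplit, Finset.sum_union (by
    rw [Finset.disjoint_left]; intro a; simp; omega)]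
  congr 1
  · refine Finset.sum_congr rfl fun i hi => min_eq_left ?_
    simp at hi
    exact orderStat_mono x hi.1 hi.2 hkn
  · rw [Finset.sum_congr rfl (g := fun _ => orderStat x k), Finset.sum_const, Nat.card_Ioc,
      nsmul_eq_mul, Nat.cast_sub hkn]
    intro i hi
    simp at hi
    exact min_eq_right (orderStat_mono x hk hi.1.le hi.2)

lemma codCost_self {k : ℕ} (hk : 1 ≤ k) (x : Fin k → ℝ) : codCost k x = ∑ l, x l := by
  rw [codCost_eq hk le_rfl, sub_self, zero_mul, add_zero]
  exact sum_Icc_orderStat x id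

lemma orderStat_one {c : ℕ} (x : Fin (c + 1) → ℝ) : orderStat x 1 = ⨅ b, x b := by
  apply le_antisymm
  · refine le_ciInf fun b => ?_
    rw [orderStat_eq x ⟨le_rfl, by omega⟩, ← (Tuple.sort x).apply_symm_apply b]
    exact Tuple.monotone_sort x (Fin.zero_le _)
  · rw [orderStat_eq x ⟨le_rfl, by omega⟩]
    exact ciInf_le (Set.finite_range x).bddBelow _

lemma orderStat_self {k : ℕ} (hk : 1 ≤ k) (x : Fin k → ℝ) : orderStat x k = ⨆ a, x a := by
  have : Nonempty (Fin k) := ⟨⟨0, hk⟩⟩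
  apply le_antisymm
  · rw [orderStat_eq x ⟨hk, le_rfl⟩]
    exact le_ciSup (Set.finite_range x).bddAbove _
  · refine ciSup_le fun b => ?_
    rw [orderStat_eq x ⟨hk, le_rfl⟩, ← (Tuple.sort x).apply_symm_apply b]
    exact Tuple.monotone_sort x (Fin.le_def.2 (Nat.le_sub_one_of_lt (Fin.is_lt _)))

@[fun_prop]
lemma measurable_orderStat {n : ℕ} (i : ℕ) : Measurable (fun x : Fin n → ℝ => orderStat x i) := by
  by_cases hi : 1 ≤ i ∧ i ≤ n
  · refine measurable_of_Iic fun t => ?_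
    -- The sublevel event says that at least `i` coordinates are at most `t`, a description free of
    -- the sorting permutation.
    have : (fun x : Fin n → ℝ => orderStat x i) ⁻¹' Set.Iic t =
        {x | i ≤ ∑ l, if x l ≤ t then 1 else 0} := by
      ext x
      have h := Tuple.lt_card_le_iff_apply_le_of_monotone (a := t) (j := ⟨i - 1, by omega⟩)
        (Tuple.monotone_sort x)
      rw [Finset.card_filter] at h
      have h2 := Equiv.sum_comp (Tuple.sort x) (fun l => if x l ≤ t then 1 else 0)
      simp only [Function.comp_apply] at h
      rw [h2] at h
      simp only [Set.mem_preimage, Set.mem_Iic, Set.mem_ofPred_eq]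
      rw [orderStat_eq x hi, ← h]
      omega
    rw [this]
    refine measurableSet_le measurable_const (Finset.measurable_sum _ fun l _ => ?_)
    exact Measurable.ite (measurableSet_le (measurable_pi_apply l) measurable_const)
      measurable_const measurable_const
  · have : (fun x : Fin n → ℝ => orderStat x i) = fun _ => 0 := by
      funext x; simp only [orderStat, dif_neg hi]
    rw [this]; exact measurable_const

@[fun_prop]
lemma measurable_codLatency {n : ℕ} (k : ℕ) : Measurable (fun x : Fin n → ℝ => codLatency k x) :=
  measurable_orderStat k

@[fun_prop]
lemma measurable_codCost {n : ℕ} (k : ℕ) : Measurable (fun x : Fin n → ℝ => codCost k x) := by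
  unfold codCost
  fun_prop

lemma repLatency_eq {k c : ℕ} (hk : 1 ≤ k) (x : Fin k × Fin (c + 1) → ℝ) :
    repLatency x = codLatency k (repTaskTime x) :=
  (orderStat_self hk _).symm

/-- Each of the `c + 1` copies contributes exactly the task time, and with `n = k` no task is cut
off by the job. -/
lemma repCost_eq {k c : ℕ} (hk : 1 ≤ k) (x : Fin k × Fin (c + 1) → ℝ) :
    repCost x = (c + 1) * codCost k (repTaskTime x) := by
  rw [codCost_self hk, repCost, Fintype.sum_prod_type, Finset.mul_sum]
  refine Finset.sum_congr rfl fun a _ => ?_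
  rw [Finset.sum_congr rfl (g := fun _ => repTaskTime x a)
    (fun b _ => min_eq_right (ciInf_le (Set.finite_range _).bddBelow b))]
  simp

lemma codLatency_map {k n : ℕ} (hk : 1 ≤ k) (hkn : k ≤ n) (x : Fin n → ℝ) {φ : ℝ → ℝ}
    (hφ : Monotone φ) : codLatency k (fun l => φ (x l)) = φ (codLatency k x) :=
  orderStat_map x hφ ⟨hk, hkn⟩

lemma codCost_const_add {k n : ℕ} (hk : 1 ≤ k) (hkn : k ≤ n) (s : ℝ) (x : Fin n → ℝ) :
    codCost k (fun l => s + x l) = n * s + codCost k x := by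
  unfold codCost
  rw [codLatency_map hk hkn x (φ := fun t => s + t) (fun _ _ h => add_le_add_right h s)]
  simp [min_add_add_left, Finset.sum_add_distrib]

/-! ### Memorylessness and Rényi's recursion -/

lemma expMeasure_eq_withDensity (r : ℝ) :
    expMeasure r = volume.withDensity (exponentialPDF r) := rfl

lemma measurable_exponentialPDF (r : ℝ) : Measurable (exponentialPDF r) :=
  (measurable_exponentialPDFReal r).ennreal_ofReal

instance nullSingletonClass_expMeasure (r : ℝ) : NullSingletonClass (expMeasure r) where
  measure_singleton x := withDensity_absolutelyContinuous _ _ (measure_singleton x)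

lemma ae_expMeasure_nonneg (r : ℝ) : ∀ᵐ x ∂(expMeasure r), 0 ≤ x := by
  rw [expMeasure_eq_withDensity, ae_withDensity_iff (measurable_exponentialPDF r)]
  refine ae_of_all _ fun x hx => ?_
  by_contra h
  exact hx (exponentialPDF_of_neg (not_le.1 h))

/-- Memorylessness of the exponential law. -/
lemma expMeasure_Ioi_inter {r m : ℝ} (hm : 0 ≤ m) {s : Set ℝ}
    (hs : MeasurableSet s) :
    (expMeasure r).restrict (Set.Ioi m) s =
      ENNReal.ofReal (Real.exp (-(r * m))) * expMeasure r ((fun x => m + x) ⁻¹' s) := by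
  have hs' : MeasurableSet ((fun x => m + x) ⁻¹' s) := hs.preimage (by fun_prop)
  -- The closed half-line matches the support of the density, so after translation by `m` both
  -- integrands vanish exactly for negative arguments or outside `s`.
  rw [Measure.restrict_congr_set Ioi_ae_eq_Ici, Measure.restrict_apply hs,
    expMeasure_eq_withDensity, withDensity_apply _ (hs.inter measurableSet_Ici),
    withDensity_apply _ hs', ← lintegral_indicator (hs.inter measurableSet_Ici),
    ← lintegral_indicator hs', ← lintegral_const_mul _ ((measurable_exponentialPDF r).indicator hs'),
    ← lintegral_add_left_eq_self _ m]
  refine lintegral_congr fun x => ?_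
  by_cases hx : m + x ∈ s
  · by_cases h0 : 0 ≤ x
    · rw [Set.indicator_of_mem (Set.mem_inter hx (by simpa using h0)), Set.indicator_of_mem (by exact hx),
        exponentialPDF_of_nonneg (by positivity), exponentialPDF_of_nonneg h0,
        ← ENNReal.ofReal_mul (by positivity)]
      congr 1
      rw [mul_add, neg_add, Real.exp_add]
      ring
    · rw [Set.indicator_of_notMem (by simp [h0]), Set.indicator_of_mem (by exact hx),
        exponentialPDF_of_neg (not_le.1 h0), mul_zero]
  · rw [Set.indicator_of_notMem (by simp [hx]), Set.indicator_of_notMem (by exact hx), mul_zero]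

/-- Memorylessness in each coordinate, multiplied over boxes. -/
lemma restrict_sampleMeasure_expMeasure {r m : ℝ} (hr : 0 < r) (hm : 0 ≤ m) (n : ℕ) :
    (sampleMeasure (expMeasure r) n).restrict (Set.univ.pi fun _ => Set.Ioi m) =
      ENNReal.ofReal (Real.exp (-(n * r * m))) •
        (sampleMeasure (expMeasure r) n).map (fun y l => m + y l) := by
  have := isProbabilityMeasure_expMeasure hr
  rw [sampleMeasure, Measure.restrict_pi_pi]
  refine Measure.pi_eq fun s hs => ?_
  rw [Measure.smul_apply, Measure.map_apply (by fun_prop) (MeasurableSet.univ_pi hs), smul_eq_mul]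
  have : (fun (y : Fin n → ℝ) l => m + y l) ⁻¹' Set.univ.pi s =
      Set.univ.pi fun l => (fun x => m + x) ⁻¹' s l := by
    ext; simp
  rw [this, Measure.pi_pi, Finset.prod_congr rfl fun i _ => expMeasure_Ioi_inter hm (hs i),
    Finset.prod_mul_distrib, Finset.prod_const, Finset.card_univ, Fintype.card_fin,
    ← ENNReal.ofReal_pow (by positivity), ← Real.exp_nat_mul]
  congr 4
  ring

lemma ae_sampleMeasure_ne {ν : Measure ℝ} [SigmaFinite ν] [NullSingletonClass ν] {n : ℕ}
    {a b : Fin (n + 1)} (hab : a ≠ b) : ∀ᵐ x ∂(sampleMeasure ν (n + 1)), x a ≠ x b := by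
  obtain ⟨b, rfl⟩ := Fin.exists_succAbove_eq hab.symm
  have hmp := measurePreserving_piFinSuccAbove (fun _ : Fin (n + 1) => ν) a
  have hs : MeasurableSet {p : ℝ × (Fin n → ℝ) | p.1 = p.2 b} :=
    measurableSet_eq_fun (by fun_prop) (by fun_prop)
  have h0 : (ν.prod (Measure.pi fun _ : Fin n => ν)) {p | p.1 = p.2 b} = 0 := by
    rw [Measure.measure_prod_null hs]
    refine ae_of_all _ fun m => ?_
    have := Measure.pi_hyperplane (fun _ : Fin n => ν) b m
    simpa [Set.preimage, eq_comm] using this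
  rw [ae_iff]
  rw [← hmp.measure_preimage hs.nullMeasurableSet] at h0
  exact (congrArg _ (Set.ext fun x => not_not)).trans h0

/-- Without atoms there are almost surely no ties, so the events "coordinate `l` is the strict
minimum" partition the space. -/
lemma ae_sum_indicator_argmin {ν : Measure ℝ} [SigmaFinite ν] [NullSingletonClass ν] {n : ℕ}
    (G : (Fin (n + 1) → ℝ) → ℝ≥0∞) :
    ∀ᵐ x ∂(sampleMeasure ν (n + 1)),
      G x = ∑ l, {x | ∀ j, x l < x (l.succAbove j)}.indicator G x := by
  have h : ∀ᵐ x ∂(sampleMeasure ν (n + 1)), ∀ a b, a ≠ b → x a ≠ x b := by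
    rw [ae_all_iff]; intro a
    rw [ae_all_iff]; intro b
    by_cases hab : a = b
    · simp [hab]
    · filter_upwards [ae_sampleMeasure_ne (ν := ν) hab] with x hx _ using hx
  filter_upwards [h] with x hx
  obtain ⟨l, -, hl⟩ := Finset.exists_min_image Finset.univ x Finset.univ_nonempty
  have hl' : ∀ j, j ≠ l → x l < x j := fun j hj =>
    lt_of_le_of_ne (hl j (Finset.mem_univ _)) (hx _ _ hj.symm)
  rw [Finset.sum_eq_single l, Set.indicator_of_mem]
  · exact fun j => hl' _ (Fin.succAbove_ne l j)
  · intro p _ hp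
    rw [Set.indicator_of_notMem]
    intro hmem
    obtain ⟨j, rfl⟩ := Fin.exists_succAbove_eq hp.symm
    exact (hmem j).not_gt (hl' _ hp)
  · simp

/-- The least of `n + 1` exponential samples is exponential with rate `(n + 1) r`, and the excesses
of the other samples over it form a fresh sample. -/
lemma lintegral_sampleMeasure_expMeasure_succ {r : ℝ} (hr : 0 < r) (n : ℕ)
    {G : (Fin (n + 1) → ℝ) → ℝ≥0∞} (hG : Measurable G)
    (hsymm : ∀ x (σ : Equiv.Perm (Fin (n + 1))), G (x ∘ σ) = G x) :
    ∫⁻ x, G x ∂(sampleMeasure (expMeasure r) (n + 1)) =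
      ∫⁻ m, ∫⁻ y, G (Fin.cons m fun l => m + y l) ∂(sampleMeasure (expMeasure r) n)
        ∂(expMeasure ((n + 1) * r)) := by
  have := isProbabilityMeasure_expMeasure hr
  set ν := expMeasure r
  have hA : ∀ l : Fin (n + 1), MeasurableSet {x : Fin (n + 1) → ℝ | ∀ j, x l < x (l.succAbove j)} :=
    fun l => by measurability
  have hcons : Measurable fun p : ℝ × (Fin n → ℝ) => (Fin.cons p.1 p.2 : Fin (n + 1) → ℝ) := by
    refine measurable_pi_iff.2 fun l => ?_
    induction l using Fin.cases <;> simp <;> fun_prop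
  have hinner : Measurable fun m : ℝ => ∫⁻ y, G (Fin.cons m fun l => m + y l) ∂(sampleMeasure ν n) := by
    have : SFinite (sampleMeasure ν n) := by unfold sampleMeasure; infer_instance
    refine Measurable.lintegral_prod_right' (f := fun p : ℝ × (Fin n → ℝ) =>
      G (Fin.cons p.1 fun l => p.1 + p.2 l)) ?_
    exact hG.comp (hcons.comp (f := fun p : ℝ × (Fin n → ℝ) => (p.1, fun l => p.1 + p.2 l))
      (by fun_prop))
  set K : ℝ → ℝ≥0∞ := fun m => ∫⁻ y, G (Fin.cons m fun l => m + y l) ∂(sampleMeasure ν n)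
  -- By symmetry of `G` the contribution does not depend on which coordinate is minimal.
  have hl : ∀ l : Fin (n + 1),
      ∫⁻ x, {x | ∀ j, x l < x (l.succAbove j)}.indicator G x ∂(sampleMeasure ν (n + 1)) =
        ∫⁻ m, ENNReal.ofReal (Real.exp (-(n * r * m))) * K m ∂ν := by
    intro l
    have hmp := (measurePreserving_piFinSuccAbove (fun _ : Fin (n + 1) => ν) l).symm
    rw [sampleMeasure, ← hmp.lintegral_comp (hG.indicator (hA l)),
      lintegral_prod (fun p => {x | ∀ j, x l < x (l.succAbove j)}.indicator G
        ((MeasurableEquiv.piFinSuccAbove (fun _ => ℝ) l).symm p))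
        ((hG.indicator (hA l)).comp hmp.measurable).aemeasurable]
    refine lintegral_congr_ae ?_
    filter_upwards [ae_expMeasure_nonneg r] with m hm
    have h1 : ∀ y : Fin n → ℝ, {x | ∀ j, x l < x (l.succAbove j)}.indicator G
        ((MeasurableEquiv.piFinSuccAbove (fun _ => ℝ) l).symm (m, y)) =
        (Set.univ.pi fun _ => Set.Ioi m).indicator (fun y => G (Fin.cons m y)) y := by
      intro y
      have h2 : (MeasurableEquiv.piFinSuccAbove (fun _ => ℝ) l).symm (m, y) =
        (l.insertNth m y : Fin (n + 1) → ℝ) := rfl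
      -- A cyclic permutation moves the minimal coordinate from position `l` to the front.
      have h3 : G (l.insertNth m y) = G (Fin.cons m y) := by
        rw [← hsymm (Fin.cons m y) l.cycleRange, Fin.cons_comp_cycleRange]
      rw [h2]
      simp only [Set.indicator, Set.mem_ofPred_eq, Fin.insertNth_apply_same,
        Fin.insertNth_apply_succAbove, Set.mem_pi, Set.mem_univ, Set.mem_Ioi, true_imp_iff, h3]
    have hGm : Measurable fun y : Fin n → ℝ => G (Fin.cons m y) :=
      hG.comp (hcons.comp (by fun_prop : Measurable fun y : Fin n → ℝ => (m, y)))
    simp_rw [h1]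
    rw [lintegral_indicator (MeasurableSet.univ_pi fun _ => measurableSet_Ioi)]
    have := restrict_sampleMeasure_expMeasure hr hm n
    rw [sampleMeasure] at this
    rw [this, lintegral_smul_measure, lintegral_map hGm (by fun_prop), smul_eq_mul]
    rfl
  -- The `n + 1` equal contributions turn the density `r exp (-r m)` times `exp (-n r m)` into the
  -- density of rate `(n + 1) r`.
  rw [lintegral_congr_ae (ae_sum_indicator_argmin G),
    lintegral_finsetSum _ fun l _ => hG.indicator (hA l), Finset.sum_congr rfl fun l _ => hl l,
    Finset.sum_const, Finset.card_univ, Fintype.card_fin, nsmul_eq_mul]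
  clear_value K
  rw [show ν = volume.withDensity (exponentialPDF r) from rfl,
    lintegral_withDensity_eq_lintegral_mul _ (measurable_exponentialPDF r)
      (by exact Measurable.mul (by fun_prop) hinner),
    expMeasure_eq_withDensity,
    lintegral_withDensity_eq_lintegral_mul _ (measurable_exponentialPDF _) hinner,
    ← lintegral_const_mul _ (by
      exact (measurable_exponentialPDF r).mul (Measurable.mul (by fun_prop) hinner))]
  refine lintegral_congr fun m => ?_
  simp only [Pi.mul_apply]
  rw [← mul_assoc, ← mul_assoc]
  congr 1
  by_cases hm : 0 ≤ m
  · rw [exponentialPDF_of_nonneg hm, exponentialPDF_of_nonneg hm, ← ENNReal.ofReal_natCast,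
      ← ENNReal.ofReal_mul (by positivity), ← ENNReal.ofReal_mul (by positivity)]
    congr 1
    push_cast
    rw [show -((n + 1) * r * m) = -(r * m) + -(n * r * m) by ring, Real.exp_add]
    ring
  · rw [exponentialPDF_of_neg (not_le.1 hm), exponentialPDF_of_neg (not_le.1 hm)]
    simp

instance isProbabilityMeasure_sampleMeasure (ν : Measure ℝ) [IsProbabilityMeasure ν] (n : ℕ) :
    IsProbabilityMeasure (sampleMeasure ν n) := by
  unfold sampleMeasure; infer_instance

lemma ae_sampleMeasure {ν : Measure ℝ} [SigmaFinite ν] {p : ℝ → Prop}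
    (h : ∀ᵐ x ∂ν, p x) (n : ℕ) : ∀ᵐ x ∂(sampleMeasure ν n), ∀ l, p (x l) :=
  ae_all_iff.2 fun _ => Measure.tendsto_eval_ae_ae.eventually h

/-- Joint law of two order statistics of an exponential sample, by recursion on the sample size. -/
lemma map_orderStat_succ {r : ℝ} (hr : 0 < r) {n i j : ℕ} (hi : i ≤ n) (hj : j ≤ n) :
    (sampleMeasure (expMeasure r) (n + 1)).map
        (fun x => (orderStat x (i + 1), orderStat x (j + 1))) =
      ((expMeasure ((n + 1) * r)).prod (sampleMeasure (expMeasure r) n)).map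
        (fun p => (p.1 + orderStat p.2 i, p.1 + orderStat p.2 j)) := by
  have := isProbabilityMeasure_expMeasure hr
  refine Measure.ext_of_lintegral _ fun f hf => ?_
  rw [lintegral_map hf (by fun_prop), lintegral_map hf (by fun_prop),
    lintegral_prod _ (by fun_prop),
    lintegral_sampleMeasure_expMeasure_succ hr n
      (G := fun x => f (orderStat x (i + 1), orderStat x (j + 1))) (by fun_prop)
      (fun x σ => by simp only [orderStat_comp_perm])]
  refine lintegral_congr fun m => lintegral_congr_ae ?_
  -- Nonnegative excesses make `m` the least entry, as `orderStat_cons` requires.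
  filter_upwards [ae_sampleMeasure (ae_expMeasure_nonneg r) n] with y hy
  have key : ∀ i ≤ n, orderStat (Fin.cons m fun l => m + y l : Fin (n + 1) → ℝ) (i + 1) =
      m + orderStat y i := by
    intro i hi
    rw [orderStat_cons _ _ (fun l => by simpa using hy l) hi]
    split_ifs with h
    · simp [h]
    · exact orderStat_map y (φ := fun t => m + t) (fun _ _ h => add_le_add_right h m) ⟨by omega, hi⟩
  rw [key i hi, key j hj]

/-- The recursion at `i = j = 0`, where the smaller sample contributes nothing. -/
lemma map_orderStat_one {r : ℝ} (hr : 0 < r) (n : ℕ) :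
    (sampleMeasure (expMeasure r) (n + 1)).map (fun x => orderStat x 1) =
      expMeasure ((n + 1) * r) := by
  have := isProbabilityMeasure_expMeasure hr
  have h := congrArg (Measure.map Prod.fst) (map_orderStat_succ hr (Nat.zero_le n) (Nat.zero_le n))
  rw [Measure.map_map (by fun_prop) (by fun_prop), Measure.map_map (by fun_prop) (by fun_prop)] at h
  have h1 : ((expMeasure ((n + 1) * r)).prod (sampleMeasure (expMeasure r) n)).map
      (Prod.fst ∘ fun p => (p.1 + orderStat p.2 0, p.1 + orderStat p.2 0)) =
      expMeasure ((n + 1) * r) := by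
    have : (Prod.fst ∘ fun p : ℝ × (Fin n → ℝ) => (p.1 + orderStat p.2 0, p.1 + orderStat p.2 0)) =
      Prod.fst := by ext; simp
    rw [this, Measure.map_fst_prod]
    simp
  rw [← h1, ← h]
  rfl

/-! ### Polynomial moments of exponential order statistics -/

lemma expMeasure_eq_restrict (r : ℝ) : expMeasure r =
    (volume.restrict (Set.Ioi 0)).withDensity fun x => ENNReal.ofReal (r * Real.exp (-(r * x))) := by
  rw [← Measure.restrict_congr_set Ioi_ae_eq_Ici.symm, expMeasure_eq_withDensity,
    ← withDensity_indicator measurableSet_Ici]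
  congr 1
  ext x
  by_cases hx : 0 ≤ x
  · rw [exponentialPDF_of_nonneg hx, Set.indicator_of_mem (Set.mem_Ici.2 hx)]
  · rw [exponentialPDF_of_neg (not_le.1 hx), Set.indicator_of_notMem (by simpa using hx)]

lemma integrable_expMeasure_iff {r : ℝ} (hr : 0 ≤ r) (f : ℝ → ℝ) :
    Integrable f (expMeasure r) ↔
      IntegrableOn (fun x => r * Real.exp (-(r * x)) * f x) (Set.Ioi 0) := by
  rw [expMeasure_eq_restrict, integrable_withDensity_iff_integrable_smul' (by fun_prop)
    (ae_of_all _ fun _ => ENNReal.ofReal_lt_top), IntegrableOn]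
  refine integrable_congr (ae_of_all _ fun x => ?_)
  simp only [smul_eq_mul]
  rw [ENNReal.toReal_ofReal (by positivity)]

lemma integral_expMeasure {r : ℝ} (hr : 0 ≤ r) (f : ℝ → ℝ) :
    ∫ x, f x ∂(expMeasure r) = ∫ x in Set.Ioi 0, r * Real.exp (-(r * x)) * f x := by
  rw [expMeasure_eq_restrict, integral_withDensity_eq_integral_toReal_smul (by fun_prop)
    (ae_of_all _ fun _ => ENNReal.ofReal_lt_top)]
  refine integral_congr_ae (ae_of_all _ fun x => ?_)
  simp only [smul_eq_mul]
  rw [ENNReal.toReal_ofReal (by positivity)]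

lemma moment_expMeasure {r : ℝ} (hr : 0 < r) (p : ℕ) :
    Integrable (fun x => x ^ p) (expMeasure r) ∧
      ∫ x, x ^ p ∂(expMeasure r) = p.factorial / r ^ p := by
  have h := Real.integral_rpow_mul_exp_neg_mul_Ioi (a := p + 1) (by positivity) hr
  have hcongr : (fun t : ℝ => t ^ ((p : ℝ) + 1 - 1) * Real.exp (-(r * t))) =
      fun t => Real.exp (-(r * t)) * t ^ p := by
    funext t
    rw [add_sub_cancel_right, Real.rpow_natCast, mul_comm]
  rw [hcongr, Real.Gamma_nat_eq_factorial, Real.rpow_add_one (by positivity),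
    Real.rpow_natCast] at h
  -- A non-integrable function would have integral `0`, whereas the Gamma value is positive.
  have hint : IntegrableOn (fun t => Real.exp (-(r * t)) * t ^ p) (Set.Ioi 0) := by
    refine not_imp_comm.1 integral_undef ?_
    rw [h]
    positivity
  rw [integrable_expMeasure_iff hr.le, integral_expMeasure hr.le]
  simp_rw [mul_assoc r]
  refine ⟨hint.const_mul r, ?_⟩
  rw [integral_const_mul, h, one_div_pow]
  field_simp

lemma integral_exp_expMeasure {r a : ℝ} (hr : 0 < r) (ha : a < r) :
    Integrable (fun x => Real.exp (a * x)) (expMeasure r) ∧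
      ∫ x, Real.exp (a * x) ∂(expMeasure r) = r / (r - a) := by
  have hcongr : (fun x => r * Real.exp (-(r * x)) * Real.exp (a * x)) =
      fun x => r * Real.exp ((a - r) * x) := by
    funext x
    rw [mul_assoc, ← Real.exp_add]
    ring_nf
  rw [integrable_expMeasure_iff hr.le, integral_expMeasure hr.le, hcongr]
  refine ⟨(integrableOn_exp_mul_Ioi (by linarith) 0).const_mul r, ?_⟩
  rw [integral_const_mul, integral_exp_mul_Ioi (by linarith)]
  have h1 : a - r ≠ 0 := by linarith
  have h2 : r - a ≠ 0 := by linarith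
  simp only [mul_zero, Real.exp_zero]
  rw [← neg_sub r a]
  field_simp

lemma integrable_orderStat_succ_iff {r : ℝ} (hr : 0 < r) {n i j : ℕ} (hi : i ≤ n) (hj : j ≤ n)
    {f : ℝ × ℝ → ℝ} (hf : Measurable f) :
    Integrable (fun x => f (orderStat x (i + 1), orderStat x (j + 1)))
        (sampleMeasure (expMeasure r) (n + 1)) ↔
      Integrable (fun p => f (p.1 + orderStat p.2 i, p.1 + orderStat p.2 j))
        ((expMeasure ((n + 1) * r)).prod (sampleMeasure (expMeasure r) n)) := by
  have h1 := integrable_map_measure (μ := sampleMeasure (expMeasure r) (n + 1)) (g := f)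
    (f := fun x => (orderStat x (i + 1), orderStat x (j + 1)))
    hf.aestronglyMeasurable (by fun_prop)
  have h2 := integrable_map_measure (g := f)
    (μ := (expMeasure ((n + 1) * r)).prod (sampleMeasure (expMeasure r) n))
    (f := fun p => (p.1 + orderStat p.2 i, p.1 + orderStat p.2 j))
    hf.aestronglyMeasurable (by fun_prop)
  rw [map_orderStat_succ hr hi hj] at h1
  exact h1.symm.trans h2

lemma integral_orderStat_succ {r : ℝ} (hr : 0 < r) {n i j : ℕ} (hi : i ≤ n) (hj : j ≤ n)
    {f : ℝ × ℝ → ℝ} (hf : Measurable f) :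
    ∫ x, f (orderStat x (i + 1), orderStat x (j + 1)) ∂(sampleMeasure (expMeasure r) (n + 1)) =
      ∫ p, f (p.1 + orderStat p.2 i, p.1 + orderStat p.2 j)
        ∂((expMeasure ((n + 1) * r)).prod (sampleMeasure (expMeasure r) n)) := by
  rw [← integral_map (φ := fun x : Fin (n + 1) → ℝ => (orderStat x (i + 1), orderStat x (j + 1)))
    (by fun_prop) hf.aestronglyMeasurable, map_orderStat_succ hr hi hj,
    integral_map (by fun_prop) hf.aestronglyMeasurable]

/-- Mean of an exponential order statistic. -/
lemma mean_orderStat_expMeasure {r : ℝ} (hr : 0 < r) (n i : ℕ) (hi : i ≤ n) :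
    Integrable (fun x => orderStat x i) (sampleMeasure (expMeasure r) n) ∧
      ∫ x, orderStat x i ∂(sampleMeasure (expMeasure r) n) =
        ((harmonic n : ℝ) - harmonic (n - i)) / r := by
  have := isProbabilityMeasure_expMeasure hr
  induction n generalizing i with
  | zero =>
    obtain rfl : i = 0 := by omega
    simp
  | succ n ih =>
    rcases i with _ | i
    · simp
    have hi' : i ≤ n := by omega
    obtain ⟨h1, h2⟩ := ih i hi'
    have hr' : 0 < ((n : ℝ) + 1) * r := by positivity
    have := isProbabilityMeasure_expMeasure hr'
    obtain ⟨m1, m2⟩ := moment_expMeasure hr' 1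
    simp only [pow_one, Nat.factorial_one, Nat.cast_one] at m1 m2
    have i1 : Integrable (fun p : ℝ × (Fin n → ℝ) => p.1)
      ((expMeasure ((n + 1) * r)).prod (sampleMeasure (expMeasure r) n)) := m1.comp_fst _
    have i2 : Integrable (fun p : ℝ × (Fin n → ℝ) => orderStat p.2 i)
      ((expMeasure ((n + 1) * r)).prod (sampleMeasure (expMeasure r) n)) := h1.comp_snd _
    refine ⟨(integrable_orderStat_succ_iff hr hi' hi' measurable_fst).2 (i1.add i2), ?_⟩
    rw [integral_orderStat_succ hr hi' hi' measurable_fst]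
    rw [integral_add i1 i2, integral_fun_fst (fun x : ℝ => x),
      integral_fun_snd (fun y : Fin n → ℝ => orderStat y i), m2, h2, Nat.add_sub_add_right,
      harmonic_succ]
    simp only [probReal_univ, one_smul]
    push_cast
    field_simp
    ring

lemma harmonicTwo_succ (n : ℕ) : harmonicTwo (n + 1) = harmonicTwo n + 1 / ((n : ℝ) + 1) ^ 2 := by
  rw [harmonicTwo, Finset.sum_Icc_succ_top (by omega), harmonicTwo]
  push_cast
  rfl

/-- Joint moment of two exponential order statistics. -/
lemma jointMoment_expMeasure {r : ℝ} (hr : 0 < r) (n i j : ℕ) (hij : i ≤ j) (hj : j ≤ n) :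
    Integrable (fun x => orderStat x i * orderStat x j) (sampleMeasure (expMeasure r) n) ∧
      jointMoment (expMeasure r) n i j =
        1 / r ^ 2 * (harmonicTwo n - harmonicTwo (n - i) +
          ((harmonic n : ℝ) - (harmonic (n - i) : ℝ)) *
            ((harmonic n : ℝ) - (harmonic (n - j) : ℝ))) := by
  have := isProbabilityMeasure_expMeasure hr
  induction n generalizing i j with
  | zero =>
    obtain rfl : i = 0 := by omega
    simp [jointMoment]
  | succ n ih =>
    rcases i with _ | i
    · simp [jointMoment]
    rcases j with _ | j
    · omega
    have hi' : i ≤ n := by omega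
    have hj' : j ≤ n := by omega
    obtain ⟨h1, h2⟩ := ih i j (by omega) hj'
    obtain ⟨a1, a2⟩ := mean_orderStat_expMeasure hr n i hi'
    obtain ⟨b1, b2⟩ := mean_orderStat_expMeasure hr n j hj'
    have hr' : 0 < ((n : ℝ) + 1) * r := by positivity
    have := isProbabilityMeasure_expMeasure hr'
    obtain ⟨m1, m2⟩ := moment_expMeasure hr' 1
    obtain ⟨q1, q2⟩ := moment_expMeasure hr' 2
    simp only [pow_one, Nat.factorial_one, Nat.cast_one] at m1 m2
    have i1 : Integrable (fun p : ℝ × (Fin n → ℝ) => p.1 ^ 2)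
      ((expMeasure ((n + 1) * r)).prod (sampleMeasure (expMeasure r) n)) := q1.comp_fst _
    have i2 : Integrable (fun p : ℝ × (Fin n → ℝ) => p.1 * (orderStat p.2 i + orderStat p.2 j))
      ((expMeasure ((n + 1) * r)).prod (sampleMeasure (expMeasure r) n)) := m1.mul_prod (a1.add b1)
    have i3 : Integrable (fun p : ℝ × (Fin n → ℝ) => orderStat p.2 i * orderStat p.2 j)
      ((expMeasure ((n + 1) * r)).prod (sampleMeasure (expMeasure r) n)) := h1.comp_snd _
    have hf : Measurable fun p : ℝ × ℝ => p.1 * p.2 := by fun_prop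
    -- The second moment of `M` is `2 / ((n + 1) r) ^ 2`: one half extends `harmonicTwo`, the other,
    -- with the cross terms, extends the product of harmonic differences.
    have hexp : (fun p : ℝ × (Fin n → ℝ) => (p.1 + orderStat p.2 i) * (p.1 + orderStat p.2 j)) =
        fun p => p.1 ^ 2 + p.1 * (orderStat p.2 i + orderStat p.2 j) +
          orderStat p.2 i * orderStat p.2 j := by
      funext p; ring
    refine ⟨(integrable_orderStat_succ_iff hr hi' hj' hf).2 ?_, ?_⟩
    · simp only [hexp]
      exact (i1.add i2).add i3
    rw [jointMoment, integral_orderStat_succ hr hi' hj' hf]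
    simp only [hexp]
    have i12 : Integrable (fun p : ℝ × (Fin n → ℝ) =>
      p.1 ^ 2 + p.1 * (orderStat p.2 i + orderStat p.2 j))
      ((expMeasure ((n + 1) * r)).prod (sampleMeasure (expMeasure r) n)) := i1.add i2
    rw [integral_add i12 i3, integral_add i1 i2, integral_fun_fst (fun x : ℝ => x ^ 2),
      integral_prod_mul (fun x : ℝ => x) (fun y : Fin n → ℝ => orderStat y i + orderStat y j),
      integral_fun_snd (fun y : Fin n → ℝ => orderStat y i * orderStat y j), m2, q2,
      integral_add a1 b1, a2, b2, ← jointMoment, h2, Nat.add_sub_add_right, Nat.add_sub_add_right,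
      harmonic_succ, harmonicTwo_succ]
    simp only [probReal_univ, one_smul, Nat.factorial_two]
    push_cast
    field_simp
    ring

/-! ### Exponential moments and Gamma ratios -/

/-- The first factor is the mean of `exp (a M)` for `M` of rate `(n + 1) r`; it equals `(n + 1) / (n
+ 1 - a / r)`, which the factorial and the Gamma functional equation absorb. -/
lemma factorial_div_Gamma_succ {r a : ℝ} (hr : 0 < r) (n : ℕ) (ha : a < (n + 1) * r) :
    ((n + 1) * r) / ((n + 1) * r - a) * (n.factorial / Real.Gamma (n + 1 - a / r)) =
      (n + 1).factorial / Real.Gamma ((n + 1 : ℕ) + 1 - a / r) := by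
  have h : 0 < (n : ℝ) + 1 - a / r := by
    rw [sub_pos, div_lt_iff₀ hr]; exact ha
  have hG := (Real.Gamma_pos_of_pos h).ne'
  have h2 : ((n + 1 : ℕ) : ℝ) + 1 - a / r = (n + 1 - a / r) + 1 := by push_cast; ring
  have h3 : (n + 1) * r - a = r * (n + 1 - a / r) := by field_simp
  rw [h2, Real.Gamma_add_one h.ne', h3, Nat.factorial_succ]
  have := h.ne'
  generalize (n : ℝ) + 1 - a / r = u at *
  push_cast
  field_simp

/-- Exponential moment of an exponential order statistic. -/
lemma integral_exp_orderStat {r : ℝ} (hr : 0 < r) (n i : ℕ) (hi : i ≤ n)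
    (h : 1 < ((n : ℝ) - i + 1) * r) :
    Integrable (fun x => Real.exp (orderStat x i)) (sampleMeasure (expMeasure r) n) ∧
      ∫ x, Real.exp (orderStat x i) ∂(sampleMeasure (expMeasure r) n) =
        n.factorial / Real.Gamma (n + 1 - 1 / r) *
          (Real.Gamma ((n : ℝ) - i + 1 - 1 / r) / Real.Gamma ((n : ℝ) - i + 1)) := by
  have := isProbabilityMeasure_expMeasure hr
  -- The recursion stops when the index reaches `0`, at any remaining sample size; both sides are
  -- then `1`.
  have base : ∀ n : ℕ, 1 < ((n : ℝ) - (0 : ℕ) + 1) * r →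
      Integrable (fun x => Real.exp (orderStat x 0)) (sampleMeasure (expMeasure r) n) ∧
      ∫ x, Real.exp (orderStat x 0) ∂(sampleMeasure (expMeasure r) n) =
        n.factorial / Real.Gamma (n + 1 - 1 / r) *
          (Real.Gamma ((n : ℝ) - (0 : ℕ) + 1 - 1 / r) / Real.Gamma ((n : ℝ) - (0 : ℕ) + 1)) := by
    intro n h
    have hpos : 0 < (n : ℝ) + 1 - 1 / r := by
      rw [sub_pos, div_lt_iff₀ hr]; simpa using h
    have hG := (Real.Gamma_pos_of_pos hpos).ne'
    refine ⟨by simp, ?_⟩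
    simp only [orderStat_zero, Real.exp_zero, integral_const, probReal_univ, Nat.cast_zero, sub_zero,
      Real.Gamma_nat_eq_factorial, smul_eq_mul]
    generalize Real.Gamma ((n : ℝ) + 1 - 1 / r) = g at hG
    have := n.factorial_ne_zero
    field_simp
  induction n generalizing i with
  | zero =>
    obtain rfl : i = 0 := by omega
    exact base 0 h
  | succ n ih =>
    rcases i with _ | i
    · exact base _ h
    have hi' : i ≤ n := by omega
    have hc : ((n + 1 : ℕ) : ℝ) - (i + 1 : ℕ) = n - i := by push_cast; ring
    rw [hc] at h ⊢
    obtain ⟨h1, h2⟩ := ih i hi' h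
    have hr' : 0 < ((n : ℝ) + 1) * r := by positivity
    -- The hypothesis depends on `n - i` only, so it passes to the smaller sample and also makes the
    -- moment of `M` finite.
    have ha : 1 < ((n : ℝ) + 1) * r := h.trans_le (by gcongr; simp)
    have := isProbabilityMeasure_expMeasure hr'
    obtain ⟨m1, m2⟩ := integral_exp_expMeasure hr' ha
    simp only [one_mul] at m1 m2
    have hf : Measurable fun p : ℝ × ℝ => Real.exp p.1 := by fun_prop
    refine ⟨(integrable_orderStat_succ_iff hr hi' hi' hf).2 ?_, ?_⟩
    · simp only [Real.exp_add]
      exact m1.mul_prod h1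
    rw [integral_orderStat_succ hr hi' hi' hf]
    simp only [Real.exp_add]
    rw [integral_prod_mul (fun x => Real.exp x) (fun y : Fin n → ℝ => Real.exp (orderStat y i)),
      m2, h2, ← mul_assoc, factorial_div_Gamma_succ hr n ha]

/-- Joint exponential moment of two exponential order statistics. -/
lemma integral_exp_orderStat_mul {r : ℝ} (hr : 0 < r) (n i j : ℕ) (hij : i ≤ j) (hj : j ≤ n)
    (h2r : 2 < ((n : ℝ) - i + 1) * r) (h1r : 1 < ((n : ℝ) - j + 1) * r) :
    Integrable (fun x => Real.exp (orderStat x i) * Real.exp (orderStat x j))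
        (sampleMeasure (expMeasure r) n) ∧
      ∫ x, Real.exp (orderStat x i) * Real.exp (orderStat x j) ∂(sampleMeasure (expMeasure r) n) =
        n.factorial / Real.Gamma (n + 1 - 2 / r) *
          (Real.Gamma ((n : ℝ) - i + 1 - 2 / r) / Real.Gamma ((n : ℝ) - i + 1 - 1 / r)) *
          (Real.Gamma ((n : ℝ) - j + 1 - 1 / r) / Real.Gamma ((n : ℝ) - j + 1)) := by
  have := isProbabilityMeasure_expMeasure hr
  -- At `i = 0` one factor is `1`, leaving the single-index moment.
  have base : ∀ n j : ℕ, j ≤ n → 2 < ((n : ℝ) - (0 : ℕ) + 1) * r → 1 < ((n : ℝ) - j + 1) * r →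
      Integrable (fun x => Real.exp (orderStat x 0) * Real.exp (orderStat x j))
        (sampleMeasure (expMeasure r) n) ∧
      ∫ x, Real.exp (orderStat x 0) * Real.exp (orderStat x j) ∂(sampleMeasure (expMeasure r) n) =
        n.factorial / Real.Gamma (n + 1 - 2 / r) *
          (Real.Gamma ((n : ℝ) - (0 : ℕ) + 1 - 2 / r) /
            Real.Gamma ((n : ℝ) - (0 : ℕ) + 1 - 1 / r)) *
          (Real.Gamma ((n : ℝ) - j + 1 - 1 / r) / Real.Gamma ((n : ℝ) - j + 1)) := by
    intro n j hj h2r h1r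
    have hpos : 0 < (n : ℝ) + 1 - 2 / r := by
      rw [sub_pos, div_lt_iff₀ hr]; simpa using h2r
    have hG := (Real.Gamma_pos_of_pos hpos).ne'
    obtain ⟨h1, h2⟩ := integral_exp_orderStat hr n j hj h1r
    simp only [orderStat_zero, Real.exp_zero, one_mul, Nat.cast_zero, sub_zero]
    refine ⟨h1, ?_⟩
    rw [h2, div_mul_div_cancel₀ hG]
  induction n generalizing i j with
  | zero =>
    obtain rfl : i = 0 := by omega
    exact base 0 j hj h2r h1r
  | succ n ih =>
    rcases i with _ | i
    · exact base _ j hj h2r h1r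
    rcases j with _ | j
    · omega
    have hi' : i ≤ n := by omega
    have hj' : j ≤ n := by omega
    have hc : ∀ i : ℕ, ((n + 1 : ℕ) : ℝ) - (i + 1 : ℕ) = n - i := fun i => by push_cast; ring
    rw [hc] at h2r h1r
    rw [hc, hc]
    obtain ⟨h1, h2⟩ := ih i j (by omega) hj' h2r h1r
    have hr' : 0 < ((n : ℝ) + 1) * r := by positivity
    have ha : 2 < ((n : ℝ) + 1) * r := h2r.trans_le (by gcongr; simp)
    have := isProbabilityMeasure_expMeasure hr'
    obtain ⟨m1, m2⟩ := integral_exp_expMeasure hr' ha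
    have hf : Measurable fun p : ℝ × ℝ => Real.exp p.1 * Real.exp p.2 := by fun_prop
    -- The minimum enters both factors, hence the exponent `2` and the shift `2 / r`.
    have hexp : (fun p : ℝ × (Fin n → ℝ) =>
        Real.exp (p.1 + orderStat p.2 i) * Real.exp (p.1 + orderStat p.2 j)) =
        fun p => Real.exp (2 * p.1) * (Real.exp (orderStat p.2 i) * Real.exp (orderStat p.2 j)) := by
      funext p
      simp only [← Real.exp_add]
      ring_nf
    refine ⟨(integrable_orderStat_succ_iff hr hi' hj' hf).2 ?_, ?_⟩
    · simp only [hexp]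
      exact m1.mul_prod h1
    rw [integral_orderStat_succ hr hi' hj' hf]
    simp only [hexp]
    rw [integral_prod_mul (fun x => Real.exp (2 * x))
        (fun y : Fin n → ℝ => Real.exp (orderStat y i) * Real.exp (orderStat y j)),
      m2, h2, ← mul_assoc, ← mul_assoc, factorial_div_Gamma_succ hr n ha]

/-! ### Pareto samples as images of exponential samples -/

/-- The Pareto law is the law of the rescaled exponential of an exponential variable. -/
lemma paretoMeasure_eq_map {s : ℝ} (hs : 0 < s) (α : ℝ) :
    paretoMeasure s α = (expMeasure α).map fun x => s * Real.exp x := by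
  refine Measure.ext_of_lintegral _ fun f hf => ?_
  have himg : (fun x => s * Real.exp x) '' Set.Ici 0 = Set.Ici s := by
    ext y
    simp only [Set.mem_image, Set.mem_Ici]
    constructor
    · rintro ⟨x, hx, rfl⟩
      exact le_mul_of_one_le_right hs.le (Real.one_le_exp hx)
    · intro hy
      have h1 : 1 ≤ y / s := (one_le_div hs).2 hy
      refine ⟨Real.log (y / s), Real.log_nonneg h1, ?_⟩
      rw [Real.exp_log (by linarith)]
      field_simp
  have hp : paretoPDF s α = (Set.Ici s).indicator
      fun x => ENNReal.ofReal (α * s ^ α * x ^ (-(α + 1))) := by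
    ext x
    by_cases hx : s ≤ x
    · rw [paretoPDF_of_le hx, Set.indicator_of_mem (Set.mem_Ici.2 hx)]
    · rw [paretoPDF_of_lt (not_le.1 hx), Set.indicator_of_notMem (by simpa using hx)]
  rw [lintegral_map hf (by fun_prop), paretoMeasure, hp, withDensity_indicator measurableSet_Ici,
    lintegral_withDensity_eq_lintegral_mul _ (by fun_prop) hf, ← himg,
    lintegral_image_eq_lintegral_abs_deriv_mul measurableSet_Ici
      (fun x _ => ((Real.hasDerivAt_exp x).const_mul s).hasDerivWithinAt)
      (fun x _ y _ hxy => Real.exp_injective (mul_left_cancel₀ hs.ne' hxy)),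
    expMeasure_eq_restrict, lintegral_withDensity_eq_lintegral_mul _ (by fun_prop) (by fun_prop),
    Measure.restrict_congr_set Ioi_ae_eq_Ici]
  refine lintegral_congr fun x => ?_
  simp only [Pi.mul_apply]
  rw [← mul_assoc, ← ENNReal.ofReal_mul (abs_nonneg _)]
  congr 2
  -- The Jacobian `s exp x` times the Pareto density at `s exp x` is `α exp (-α x)`.
  rw [abs_of_pos (by positivity), Real.mul_rpow hs.le (Real.exp_pos x).le, ← Real.exp_mul,
    neg_add, Real.rpow_add hs, Real.rpow_neg hs.le, Real.rpow_neg hs.le, Real.rpow_one, mul_add,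
    Real.exp_add, mul_neg, mul_comm x α, mul_neg, mul_one, Real.exp_neg x]
  have := (Real.rpow_pos_of_pos hs α).ne'
  field_simp

lemma sampleMeasure_map (ν : Measure ℝ) [IsProbabilityMeasure ν] {φ : ℝ → ℝ} (hφ : Measurable φ)
    (n : ℕ) : sampleMeasure (ν.map φ) n = (sampleMeasure ν n).map fun x l => φ (x l) := by
  have := Measure.isProbabilityMeasure_map (μ := ν) hφ.aemeasurable
  exact (Measure.pi_map_pi (μ := fun _ : Fin n => ν) fun _ => hφ.aemeasurable).symm

lemma monotone_mul_exp {s : ℝ} (hs : 0 < s) : Monotone fun x => s * Real.exp x :=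
  fun _ _ h => mul_le_mul_of_nonneg_left (Real.exp_le_exp.2 h) hs.le

/-- Joint moment of two Pareto order statistics. -/
lemma jointMoment_paretoMeasure {s α : ℝ} (hs : 0 < s) (hα : 0 < α) (n i j : ℕ) (hi : 1 ≤ i)
    (hij : i ≤ j) (hj : j ≤ n)
    (h2r : 2 < ((n : ℝ) - i + 1) * α) (h1r : 1 < ((n : ℝ) - j + 1) * α) :
    Integrable (fun x => orderStat x i * orderStat x j) (sampleMeasure (paretoMeasure s α) n) ∧
      jointMoment (paretoMeasure s α) n i j =
        s ^ 2 * ((n.factorial : ℝ) / Real.Gamma (n + 1 - 2 / α)) *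
          (Real.Gamma ((n : ℝ) - i + 1 - 2 / α) / Real.Gamma ((n : ℝ) - i + 1 - 1 / α)) *
          (Real.Gamma ((n : ℝ) - j + 1 - 1 / α) / Real.Gamma ((n : ℝ) - j + 1)) := by
  have := isProbabilityMeasure_expMeasure hα
  obtain ⟨h1, h2⟩ := integral_exp_orderStat_mul hα n i j hij hj h2r h1r
  have hmeas : Measurable fun x : Fin n → ℝ => orderStat x i * orderStat x j := by fun_prop
  -- Positive indices matter here: the default value at index `0` is not transported by the map.
  have hord : ∀ x : Fin n → ℝ, orderStat (fun l => s * Real.exp (x l)) i *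
      orderStat (fun l => s * Real.exp (x l)) j =
      s ^ 2 * (Real.exp (orderStat x i) * Real.exp (orderStat x j)) := fun x => by
    rw [orderStat_map x (monotone_mul_exp hs) ⟨hi, hij.trans hj⟩,
      orderStat_map x (monotone_mul_exp hs) ⟨hi.trans hij, hj⟩]
    ring
  rw [jointMoment, paretoMeasure_eq_map hs, sampleMeasure_map _ (by fun_prop)]
  have hφ : Measurable fun (x : Fin n → ℝ) l => s * Real.exp (x l) := by fun_prop
  rw [integrable_map_measure hmeas.aestronglyMeasurable hφ.aemeasurable,
    integral_map hφ.aemeasurable hmeas.aestronglyMeasurable]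
  simp only [Function.comp_def, hord]
  refine ⟨h1.const_mul _, ?_⟩
  rw [integral_const_mul, h2]
  ring

/-! ### Second moments under a change of law; minima of copies -/

section Transfer

variable {Ω Ω' : Type*} [MeasurableSpace Ω] [MeasurableSpace Ω'] {P : Measure Ω} {Q : Measure Ω'}

lemma HasSecondMoment.comp_hasLaw {f : Ω' → ℝ} {m : ℝ} (h : HasSecondMoment f Q m)
    (hf : Measurable f) {Z : Ω → Ω'} (hZ : HasLaw Z Q P) :
    HasSecondMoment (fun ω => f (Z ω)) P m := by
  have hm : AEStronglyMeasurable (fun y => f y ^ 2) (P.map Z) := by fun_prop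
  constructor
  · have h1 := h.1
    rw [← hZ.map_eq] at h1
    exact (integrable_map_measure hm hZ.aemeasurable).1 h1
  · rw [← h.2, ← hZ.map_eq, integral_map hZ.aemeasurable hm]

lemma HasSecondMomentE.comp_hasLaw {f : Ω' → ℝ} {m : ℝ≥0∞} (h : HasSecondMomentE f Q m)
    (hf : Measurable f) {Z : Ω → Ω'} (hZ : HasLaw Z Q P) :
    HasSecondMomentE (fun ω => f (Z ω)) P m := by
  refine ⟨hf.comp_aemeasurable hZ.aemeasurable, ?_⟩
  rw [← h.2, ← hZ.map_eq, lintegral_map' (by fun_prop) hZ.aemeasurable]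

lemma HasSecondMoment.const_add [IsProbabilityMeasure P] {Z : Ω → ℝ} {m : ℝ}
    (h : HasSecondMoment Z P m) (hZ : Integrable Z P) (a : ℝ) :
    HasSecondMoment (fun ω => a + Z ω) P (a ^ 2 + 2 * a * ∫ ω, Z ω ∂P + m) := by
  have hsq : (fun ω => (a + Z ω) ^ 2) = fun ω => a ^ 2 + 2 * a * Z ω + Z ω ^ 2 := by
    funext ω; ring
  have i1 : Integrable (fun ω => a ^ 2 + 2 * a * Z ω) P :=
    (integrable_const _).add (hZ.const_mul _)
  unfold HasSecondMoment
  rw [hsq]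
  refine ⟨i1.add h.1, ?_⟩
  rw [integral_add i1 h.1, integral_add (integrable_const _) (hZ.const_mul _), h.2,
    integral_const_mul]
  simp

lemma HasSecondMoment.const_mul {Z : Ω → ℝ} {m : ℝ} (h : HasSecondMoment Z P m) (a : ℝ) :
    HasSecondMoment (fun ω => a * Z ω) P (a ^ 2 * m) := by
  unfold HasSecondMoment
  simp only [mul_pow]
  exact ⟨h.1.const_mul _, by rw [integral_const_mul, h.2]⟩

lemma HasSecondMomentE.natCast_mul {Z : Ω → ℝ} {m : ℝ≥0∞} (h : HasSecondMomentE Z P m) (a : ℕ) :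
    HasSecondMomentE (fun ω => a * Z ω) P ((a : ℝ≥0∞) ^ 2 * m) := by
  refine ⟨h.1.const_mul _, ?_⟩
  have hm := h.1
  rw [← h.2, ← lintegral_const_mul'' _ (by fun_prop)]
  refine lintegral_congr fun ω => ?_
  rw [mul_pow, ENNReal.ofReal_mul (by positivity), ENNReal.ofReal_pow (by positivity),
    ENNReal.ofReal_natCast]

lemma IsIID.hasLaw_sampleMeasure {n : ℕ} {X : Fin n → Ω → ℝ} {ν : Measure ℝ}
    (h : IsIID X ν P) : HasLaw (fun ω l => X l ω) (sampleMeasure ν n) P :=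
  h.1.hasLaw_pi h.2

/-- Currying makes the rows of copies independent, and the row minima inherit independence. The
currying statement for infinite products is specialized to finite index types. -/
lemma map_repTaskTime (ν : Measure ℝ) [IsProbabilityMeasure ν] (k c : ℕ) :
    (Measure.pi fun _ : Fin k × Fin (c + 1) => ν).map repTaskTime =
      sampleMeasure ((sampleMeasure ν (c + 1)).map fun x => orderStat x 1) k := by
  have hc := Measure.infinitePi_map_curry (fun (_ : Fin k) (_ : Fin (c + 1)) => ν)
  simp only [Measure.infinitePi_eq_pi] at hc
  have hmin : Measurable fun x : Fin (c + 1) → ℝ => orderStat x 1 := by fun_prop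
  have : IsProbabilityMeasure ((Measure.pi fun _ : Fin (c + 1) => ν).map fun x => orderStat x 1) :=
    Measure.isProbabilityMeasure_map hmin.aemeasurable
  have hpi := Measure.pi_map_pi (μ := fun _ : Fin k => Measure.pi fun _ : Fin (c + 1) => ν)
    (f := fun _ x => orderStat x 1) (fun _ => hmin.aemeasurable)
  simp only [sampleMeasure]
  rw [← hpi, ← hc, Measure.map_map (by fun_prop) (MeasurableEquiv.measurable _)]
  congr 1
  funext x a
  exact (orderStat_one _).symm

lemma IsIID.hasLaw_repTaskTime {k c : ℕ} {X : Fin k × Fin (c + 1) → Ω → ℝ} {ν ν' : Measure ℝ}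
    [IsProbabilityMeasure ν] (h : IsIID X ν P)
    (hν : (sampleMeasure ν (c + 1)).map (fun x => orderStat x 1) = ν') :
    HasLaw (fun ω => repTaskTime fun p => X p ω) (sampleMeasure ν' k) P := by
  have hm : Measurable (repTaskTime : (Fin k × Fin (c + 1) → ℝ) → Fin k → ℝ) := by
    refine measurable_pi_iff.2 fun a => ?_
    simp only [repTaskTime]
    fun_prop
  refine HasLaw.comp (Y := repTaskTime) ⟨hm.aemeasurable, ?_⟩ (h.1.hasLaw_pi h.2)
  rw [map_repTaskTime, hν]

/-- A monotone map commutes with minima, so the shifted exponential and Pareto cases both follow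
from the exponential one. -/
lemma map_orderStat_one_map {r : ℝ} (hr : 0 < r) {φ : ℝ → ℝ} (hφ : Monotone φ) (c : ℕ) :
    (sampleMeasure ((expMeasure r).map φ) (c + 1)).map (fun x => orderStat x 1) =
      (expMeasure ((c + 1) * r)).map φ := by
  have := isProbabilityMeasure_expMeasure hr
  have hφm : Measurable φ := hφ.measurable
  rw [sampleMeasure_map _ hφm, Measure.map_map (by fun_prop) (by fun_prop),
    ← map_orderStat_one hr, Measure.map_map hφm (by fun_prop)]
  congr 1
  funext x
  exact orderStat_map x hφ ⟨le_rfl, by omega⟩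

end Transfer

/-! ### Second moments of coded latency and cost for a general law -/

section Coding

lemma codCost_sq {k n : ℕ} (hk : 1 ≤ k) (hkn : k ≤ n) (x : Fin n → ℝ) :
    codCost k x ^ 2 = ((n : ℝ) - k) ^ 2 * (orderStat x k * orderStat x k) +
      2 * ((n : ℝ) - k) * ∑ i ∈ Finset.Icc 1 k, orderStat x i * orderStat x k +
      ∑ i ∈ Finset.Icc 1 k, ∑ j ∈ Finset.Icc 1 k, orderStat x i * orderStat x j := by
  rw [codCost_eq hk hkn, ← Finset.sum_mul, ← Finset.sum_mul_sum]
  ring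

variable {ν : Measure ℝ} {k n : ℕ}

lemma hasSecondMoment_codLatency
    (h : Integrable (fun x : Fin n → ℝ => orderStat x k * orderStat x k) (sampleMeasure ν n)) :
    HasSecondMoment (codLatency k) (sampleMeasure ν n) (jointMoment ν n k k) := by
  simp only [HasSecondMoment, codLatency, sq, jointMoment]
  exact ⟨h, trivial⟩

lemma hasSecondMoment_codCost (hk : 1 ≤ k) (hkn : k ≤ n)
    (h : ∀ i j, 1 ≤ i → i ≤ j → j ≤ k →
      Integrable (fun x : Fin n → ℝ => orderStat x i * orderStat x j) (sampleMeasure ν n)) :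
    HasSecondMoment (codCost k) (sampleMeasure ν n)
      (((n : ℝ) - k) ^ 2 * jointMoment ν n k k +
        2 * ((n : ℝ) - k) * ∑ i ∈ Finset.Icc 1 k, jointMoment ν n i k +
        ∑ i ∈ Finset.Icc 1 k, ∑ j ∈ Finset.Icc 1 k, jointMoment ν n i j) := by
  -- Ordered pairs suffice by commutativity of the product.
  have h' : ∀ i ∈ Finset.Icc 1 k, ∀ j ∈ Finset.Icc 1 k,
      Integrable (fun x : Fin n → ℝ => orderStat x i * orderStat x j) (sampleMeasure ν n) := by
    intro i hi j hj
    rw [Finset.mem_Icc] at hi hj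
    rcases le_total i j with hij | hij
    · exact h i j hi.1 hij hj.2
    · simpa only [mul_comm] using h j i hj.1 hij hi.2
  have hkk : k ∈ Finset.Icc 1 k := Finset.mem_Icc.2 ⟨hk, le_rfl⟩
  have i1 := (h' k hkk k hkk).const_mul (((n : ℝ) - k) ^ 2)
  have i2 := (integrable_finsetSum _ fun i hi => h' i hi k hkk).const_mul (2 * ((n : ℝ) - k))
  have i3 := integrable_finsetSum _ fun i hi => integrable_finsetSum _ fun j hj => h' i hi j hj
  have i12 := i1.add i2
  simp only [Pi.add_def] at i12
  unfold HasSecondMoment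
  simp only [codCost_sq hk hkn]
  refine ⟨i12.add i3, ?_⟩
  rw [integral_add i12 i3, integral_add i1 i2, integral_const_mul, integral_const_mul,
    integral_finsetSum _ fun i hi => h' i hi k hkk,
    integral_finsetSum _ fun i hi => integrable_finsetSum _ fun j hj => h' i hi j hj]
  simp only [jointMoment]
  congr 1
  exact Finset.sum_congr rfl fun i hi => integral_finsetSum _ fun j hj => h' i hi j hj

lemma hasSecondMomentE_codLatency :
    HasSecondMomentE (codLatency k) (sampleMeasure ν n) (jointMomentE ν n k k) := by
  refine ⟨(measurable_codLatency k).aemeasurable, ?_⟩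
  simp only [codLatency, sq, jointMomentE]

/-- Nonnegativity is what lets `ENNReal.ofReal` distribute over the expanded square; no
integrability is then needed. -/
lemma hasSecondMomentE_codCost [IsProbabilityMeasure ν] (hν : ∀ᵐ x ∂ν, 0 ≤ x) (hk : 1 ≤ k)
    (hkn : k ≤ n) :
    HasSecondMomentE (codCost k) (sampleMeasure ν n)
      (((n - k : ℕ) : ℝ≥0∞) ^ 2 * jointMomentE ν n k k +
        2 * ((n - k : ℕ) : ℝ≥0∞) * ∑ i ∈ Finset.Icc 1 k, jointMomentE ν n i k +
        ∑ i ∈ Finset.Icc 1 k, ∑ j ∈ Finset.Icc 1 k, jointMomentE ν n i j) := by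
  refine ⟨(measurable_codCost k).aemeasurable, ?_⟩
  have hae : ∀ᵐ x ∂(sampleMeasure ν n), ENNReal.ofReal (codCost k x ^ 2) =
      ((n - k : ℕ) : ℝ≥0∞) ^ 2 * ENNReal.ofReal (orderStat x k * orderStat x k) +
      2 * ((n - k : ℕ) : ℝ≥0∞) *
        ∑ i ∈ Finset.Icc 1 k, ENNReal.ofReal (orderStat x i * orderStat x k) +
      ∑ i ∈ Finset.Icc 1 k, ∑ j ∈ Finset.Icc 1 k,
        ENNReal.ofReal (orderStat x i * orderStat x j) := by
    filter_upwards [ae_sampleMeasure hν n] with x hx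
    have h0 : ∀ i j, 0 ≤ orderStat x i * orderStat x j := fun i j =>
      mul_nonneg (orderStat_nonneg hx i) (orderStat_nonneg hx j)
    have hs1 : 0 ≤ ∑ i ∈ Finset.Icc 1 k, orderStat x i * orderStat x k :=
      Finset.sum_nonneg fun i _ => h0 i k
    have hs2 : ∀ i, 0 ≤ ∑ j ∈ Finset.Icc 1 k, orderStat x i * orderStat x j := fun i =>
      Finset.sum_nonneg fun j _ => h0 i j
    have hs3 : 0 ≤ ∑ i ∈ Finset.Icc 1 k, ∑ j ∈ Finset.Icc 1 k, orderStat x i * orderStat x j :=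
      Finset.sum_nonneg fun i _ => hs2 i
    have hkk := h0 k k
    rw [codCost_sq hk hkn, ← Nat.cast_sub hkn, ENNReal.ofReal_add (by positivity) hs3,
      ENNReal.ofReal_add (by positivity) (by positivity),
      ENNReal.ofReal_mul (p := ((n - k : ℕ) : ℝ) ^ 2) (by positivity),
      ENNReal.ofReal_mul (p := 2 * ((n - k : ℕ) : ℝ)) (by positivity),
      ENNReal.ofReal_mul (p := 2) (by positivity),
      ENNReal.ofReal_pow (by positivity), ENNReal.ofReal_natCast, ENNReal.ofReal_ofNat,
      ENNReal.ofReal_sum_of_nonneg fun i _ => h0 i k,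
      ENNReal.ofReal_sum_of_nonneg fun i _ => hs2 i]
    congr 1
    exact Finset.sum_congr rfl fun i _ => ENNReal.ofReal_sum_of_nonneg fun j _ => h0 i j
  rw [lintegral_congr_ae hae, lintegral_add_left (by fun_prop), lintegral_add_left (by fun_prop),
    lintegral_const_mul _ (by fun_prop), lintegral_const_mul _ (by fun_prop),
    lintegral_finsetSum _ fun i _ => by fun_prop,
    lintegral_finsetSum _ fun i _ => by fun_prop]
  simp only [jointMomentE]
  congr 1
  exact Finset.sum_congr rfl fun i _ => lintegral_finsetSum _ fun j _ => by fun_prop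

end Coding

/-! ### Shifted exponential task times -/

section ShiftedExponential

/-- Passing from `k` to `k + 1` adds `(n - k) (H_{n-k} - H_{n-k-1}) = 1`. This is why the mean coded
cost in the cross term is `k / μ`, whatever `n` is. -/
lemma sum_harmonic_sub {k n : ℕ} (hkn : k ≤ n) :
    ∑ i ∈ Finset.Icc 1 k, ((harmonic n : ℝ) - harmonic (n - i)) +
      ((n : ℝ) - k) * ((harmonic n : ℝ) - harmonic (n - k)) = k := by
  induction k with
  | zero => simp
  | succ k ih =>
    have ih := ih (by omega)
    obtain ⟨d, rfl⟩ : ∃ d, n = k + 1 + d := ⟨n - (k + 1), by omega⟩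
    rw [show k + 1 + d - k = d + 1 by omega, harmonic_succ] at ih
    rw [Finset.sum_Icc_succ_top (by omega), show k + 1 + d - (k + 1) = d by omega]
    push_cast at ih ⊢
    have : ((d : ℝ) + 1) * ((d : ℝ) + 1)⁻¹ = 1 := mul_inv_cancel₀ (by positivity)
    linear_combination ih + this

lemma mean_codCost_expMeasure {r : ℝ} (hr : 0 < r) {k n : ℕ} (hk : 1 ≤ k) (hkn : k ≤ n) :
    Integrable (codCost k) (sampleMeasure (expMeasure r) n) ∧
      ∫ x, codCost k x ∂(sampleMeasure (expMeasure r) n) = k / r := by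
  have h : ∀ i ∈ Finset.Icc 1 k, _ := fun i hi =>
    mean_orderStat_expMeasure hr n i ((Finset.mem_Icc.1 hi).2.trans hkn)
  have hkk := mean_orderStat_expMeasure hr n k hkn
  have i1 := integrable_finsetSum _ fun i hi => (h i hi).1
  have i2 := hkk.1.const_mul ((n : ℝ) - k)
  have hcost : codCost k = fun x : Fin n → ℝ =>
      ∑ i ∈ Finset.Icc 1 k, orderStat x i + ((n : ℝ) - k) * orderStat x k :=
    funext fun x => codCost_eq hk hkn x
  rw [hcost]
  refine ⟨i1.add i2, ?_⟩
  rw [integral_add i1 i2, integral_const_mul, integral_finsetSum _ fun i hi => (h i hi).1,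
    Finset.sum_congr rfl fun i hi => (h i hi).2, hkk.2, ← Finset.sum_div, ← mul_div_assoc,
    ← add_div, sum_harmonic_sub hkn]

lemma sampleMeasure_sexpMeasure {s μ : ℝ} (hμ : 0 < μ) (n : ℕ) :
    sampleMeasure (sexpMeasure s μ) n =
      (sampleMeasure (expMeasure μ) n).map fun x l => s + x l := by
  have := isProbabilityMeasure_expMeasure hμ
  exact sampleMeasure_map _ (by fun_prop) n

lemma HasSecondMoment.of_comp {Ω Ω' : Type*} [MeasurableSpace Ω] [MeasurableSpace Ω']
    {P : Measure Ω} {φ : Ω → Ω'} {f : Ω' → ℝ} {m : ℝ} (hφ : Measurable φ) (hf : Measurable f)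
    (h : HasSecondMoment (fun ω => f (φ ω)) P m) : HasSecondMoment f (P.map φ) m := by
  have hm : AEStronglyMeasurable (fun y => f y ^ 2) (P.map φ) := by fun_prop
  exact ⟨(integrable_map_measure hm hφ.aemeasurable).2 h.1,
    (integral_map hφ.aemeasurable hm).trans h.2⟩

lemma hasSecondMoment_codLatency_sexp {s μ : ℝ} (hμ : 0 < μ) {k n : ℕ} (hk : 1 ≤ k)
    (hkn : k ≤ n) :
    HasSecondMoment (codLatency k) (sampleMeasure (sexpMeasure s μ) n)
      ((harmonicTwo n - harmonicTwo (n - k)) / μ ^ 2 +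
          (s + ((harmonic n : ℝ) - (harmonic (n - k) : ℝ)) / μ) ^ 2) := by
  have := isProbabilityMeasure_expMeasure hμ
  obtain ⟨h1, h2⟩ := jointMoment_expMeasure hμ n k k le_rfl hkn
  obtain ⟨a1, a2⟩ := mean_orderStat_expMeasure hμ n k hkn
  rw [sampleMeasure_sexpMeasure hμ]
  refine HasSecondMoment.of_comp (by fun_prop) (by fun_prop) ?_
  simp only [codLatency_map hk hkn _ (φ := fun t => s + t) fun _ _ h => add_le_add_right h s]
  have h := (hasSecondMoment_codLatency h1).const_add a1 s
  rw [h2] at h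
  convert h using 1
  simp only [codLatency, a2]
  field_simp
  ring

lemma hasSecondMoment_codCost_sexp {s μ : ℝ} (hμ : 0 < μ) {k n : ℕ} (hk : 1 ≤ k) (hkn : k ≤ n) :
    HasSecondMoment (codCost k) (sampleMeasure (sexpMeasure s μ) n)
      ((n * s) ^ 2 + 2 * n * s * (k / μ) +
        ((n : ℝ) - k) ^ 2 * jointMoment (expMeasure μ) n k k +
        2 * ((n : ℝ) - k) * ∑ i ∈ Finset.Icc 1 k, jointMoment (expMeasure μ) n i k +
        ∑ i ∈ Finset.Icc 1 k, ∑ j ∈ Finset.Icc 1 k, jointMoment (expMeasure μ) n i j) := by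
  have := isProbabilityMeasure_expMeasure hμ
  obtain ⟨a1, a2⟩ := mean_codCost_expMeasure hμ hk hkn
  rw [sampleMeasure_sexpMeasure hμ]
  refine HasSecondMoment.of_comp (by fun_prop) (by fun_prop) ?_
  simp only [codCost_const_add hk hkn]
  have h := (hasSecondMoment_codCost hk hkn fun i j _ hij hj =>
    (jointMoment_expMeasure hμ n i j hij (hj.trans hkn)).1).const_add a1 (n * s)
  rw [a2] at h
  convert h using 1
  ring

lemma isProbabilityMeasure_sexpMeasure (s : ℝ) {μ : ℝ} (hμ : 0 < μ) :
    IsProbabilityMeasure (sexpMeasure s μ) := by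
  have := isProbabilityMeasure_expMeasure hμ
  exact Measure.isProbabilityMeasure_map (by fun_prop)

lemma map_orderStat_one_sexp (s : ℝ) {μ : ℝ} (hμ : 0 < μ) (c : ℕ) :
    (sampleMeasure (sexpMeasure s μ) (c + 1)).map (fun x => orderStat x 1) =
      sexpMeasure s ((c + 1) * μ) :=
  map_orderStat_one_map hμ (fun _ _ h => add_le_add_right h s) c

end ShiftedExponential

/-! ### Pareto task times -/

section Pareto

lemma map_orderStat_one_pareto {s α : ℝ} (hs : 0 < s) (hα : 0 < α) (c : ℕ) :
    (sampleMeasure (paretoMeasure s α) (c + 1)).map (fun x => orderStat x 1) =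
      paretoMeasure s ((c + 1) * α) := by
  rw [paretoMeasure_eq_map hs, paretoMeasure_eq_map hs,
    map_orderStat_one_map hα (monotone_mul_exp hs) c]

lemma ae_paretoMeasure_nonneg {s : ℝ} (hs : 0 < s) (α : ℝ) : ∀ᵐ x ∂(paretoMeasure s α), 0 ≤ x := by
  rw [paretoMeasure_eq_map hs, ae_map_iff (by fun_prop) measurableSet_Ici]
  exact ae_of_all _ fun x => by positivity

/-- The moment condition weakens as the index decreases, so the one at rank `k` covers all pairs
below it. -/
lemma integrable_orderStat_pareto {s α : ℝ} (hs : 0 < s) (hα : 0 < α) {k n : ℕ} (hkn : k ≤ n)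
    (h : 2 < ((n : ℝ) - k + 1) * α) {i j : ℕ} (hi : 1 ≤ i) (hij : i ≤ j) (hj : j ≤ k) :
    Integrable (fun x : Fin n → ℝ => orderStat x i * orderStat x j)
      (sampleMeasure (paretoMeasure s α) n) := by
  have hmono : ∀ l ≤ k, 2 < ((n : ℝ) - l + 1) * α := fun l hl =>
    h.trans_le (by gcongr)
  exact (jointMoment_paretoMeasure hs hα n i j hi hij (hj.trans hkn) (hmono i (hij.trans hj))
    (by linarith [hmono j hj])).1

end Pareto

end Straggler

/-! ### Assembly of the theorem -/

open Straggler in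
theorem mainTheorem11 {Ω : Type*} [MeasurableSpace Ω] (P : Measure Ω) [IsProbabilityMeasure P] :
    -- joint moments of exponential order statistics
    (∀ μ : ℝ, 0 < μ → ∀ n i j : ℕ, 1 ≤ i → i ≤ j → j ≤ n →
      Integrable (fun x : Fin n → ℝ => orderStat x i * orderStat x j)
        (sampleMeasure (expMeasure μ) n) ∧
      jointMoment (expMeasure μ) n i j =
        1 / μ ^ 2 * (harmonicTwo n - harmonicTwo (n - i) +
          ((harmonic n : ℝ) - (harmonic (n - i) : ℝ)) *
            ((harmonic n : ℝ) - (harmonic (n - j) : ℝ)))) ∧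
    -- shifted exponential task execution times, replication
    (∀ s μ : ℝ, 0 < s → 0 < μ → ∀ k c : ℕ, 1 ≤ k → ∀ X : Fin k × Fin (c + 1) → Ω → ℝ,
      IsIID X (sexpMeasure s μ) P →
      HasSecondMoment (fun ω => repLatency (fun p => X p ω)) P
        ((s + (harmonic k : ℝ) / ((c + 1) * μ)) ^ 2 +
          harmonicTwo k / ((c + 1) ^ 2 * μ ^ 2)) ∧
      HasSecondMoment (fun ω => repCost (fun p => X p ω)) P
        ((k * (c + 1) * s) ^ 2 + 2 * k * (c + 1) * s * (k / μ) +
          (c + 1) ^ 2 * ∑ i ∈ Finset.Icc 1 k, ∑ j ∈ Finset.Icc 1 k,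
            jointMoment (expMeasure ((c + 1) * μ)) k i j)) ∧
    -- shifted exponential task execution times, coding
    (∀ s μ : ℝ, 0 < s → 0 < μ → ∀ k n : ℕ, 1 ≤ k → k ≤ n → ∀ X : Fin n → Ω → ℝ,
      IsIID X (sexpMeasure s μ) P →
      HasSecondMoment (fun ω => codLatency k (fun l => X l ω)) P
        ((harmonicTwo n - harmonicTwo (n - k)) / μ ^ 2 +
          (s + ((harmonic n : ℝ) - (harmonic (n - k) : ℝ)) / μ) ^ 2) ∧
      HasSecondMoment (fun ω => codCost k (fun l => X l ω)) P
        ((n * s) ^ 2 + 2 * n * s * (k / μ) +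
          ((n : ℝ) - k) ^ 2 * jointMoment (expMeasure μ) n k k +
          2 * ((n : ℝ) - k) * ∑ i ∈ Finset.Icc 1 k, jointMoment (expMeasure μ) n i k +
          ∑ i ∈ Finset.Icc 1 k, ∑ j ∈ Finset.Icc 1 k, jointMoment (expMeasure μ) n i j)) ∧
    -- joint moments of Pareto order statistics
    (∀ s α : ℝ, 0 < s → ∀ n i j : ℕ, 1 ≤ i → i ≤ j → j ≤ n →
      max (2 / ((n : ℝ) - i + 1)) (1 / ((n : ℝ) - j + 1)) < α →
      Integrable (fun x : Fin n → ℝ => orderStat x i * orderStat x j)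
        (sampleMeasure (paretoMeasure s α) n) ∧
      jointMoment (paretoMeasure s α) n i j =
        s ^ 2 * ((n.factorial : ℝ) / Real.Gamma (n + 1 - 2 / α)) *
          (Real.Gamma ((n : ℝ) - i + 1 - 2 / α) / Real.Gamma ((n : ℝ) - i + 1 - 1 / α)) *
          (Real.Gamma ((n : ℝ) - j + 1 - 1 / α) / Real.Gamma ((n : ℝ) - j + 1))) ∧
    -- Pareto task execution times, replication; identities in `[0, ∞]` for every `α`,
    -- and between finite real numbers when `2 < (c + 1) α`
    (∀ s α : ℝ, 0 < s → 0 < α → ∀ k c : ℕ, 1 ≤ k → ∀ X : Fin k × Fin (c + 1) → Ω → ℝ,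
      IsIID X (paretoMeasure s α) P →
      HasSecondMomentE (fun ω => repLatency (fun p => X p ω)) P
        (jointMomentE (paretoMeasure s ((c + 1) * α)) k k k) ∧
      HasSecondMomentE (fun ω => repCost (fun p => X p ω)) P
        (((c : ℝ≥0∞) + 1) ^ 2 * ∑ i ∈ Finset.Icc 1 k, ∑ j ∈ Finset.Icc 1 k,
          jointMomentE (paretoMeasure s ((c + 1) * α)) k i j) ∧
      (2 < (c + 1) * α →
        HasSecondMoment (fun ω => repLatency (fun p => X p ω)) P
          (jointMoment (paretoMeasure s ((c + 1) * α)) k k k) ∧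
        HasSecondMoment (fun ω => repCost (fun p => X p ω)) P
          ((c + 1) ^ 2 * ∑ i ∈ Finset.Icc 1 k, ∑ j ∈ Finset.Icc 1 k,
            jointMoment (paretoMeasure s ((c + 1) * α)) k i j))) ∧
    -- Pareto task execution times, coding; identities in `[0, ∞]` for every `α`,
    -- and between finite real numbers when `2 < (n - k + 1) α`
    (∀ s α : ℝ, 0 < s → 0 < α → ∀ k n : ℕ, 1 ≤ k → k ≤ n → ∀ X : Fin n → Ω → ℝ,
      IsIID X (paretoMeasure s α) P →
      HasSecondMomentE (fun ω => codLatency k (fun l => X l ω)) P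
        (jointMomentE (paretoMeasure s α) n k k) ∧
      HasSecondMomentE (fun ω => codCost k (fun l => X l ω)) P
        (((n - k : ℕ) : ℝ≥0∞) ^ 2 * jointMomentE (paretoMeasure s α) n k k +
          2 * ((n - k : ℕ) : ℝ≥0∞) *
            ∑ i ∈ Finset.Icc 1 k, jointMomentE (paretoMeasure s α) n i k +
          ∑ i ∈ Finset.Icc 1 k, ∑ j ∈ Finset.Icc 1 k, jointMomentE (paretoMeasure s α) n i j) ∧
      (2 < ((n : ℝ) - k + 1) * α →
        HasSecondMoment (fun ω => codLatency k (fun l => X l ω)) P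
          (jointMoment (paretoMeasure s α) n k k) ∧
        HasSecondMoment (fun ω => codCost k (fun l => X l ω)) P
          (((n : ℝ) - k) ^ 2 * jointMoment (paretoMeasure s α) n k k +
            2 * ((n : ℝ) - k) *
              ∑ i ∈ Finset.Icc 1 k, jointMoment (paretoMeasure s α) n i k +
            ∑ i ∈ Finset.Icc 1 k, ∑ j ∈ Finset.Icc 1 k,
              jointMoment (paretoMeasure s α) n i j))) := by
  refine ⟨fun μ hμ n i j _ hij hj => jointMoment_expMeasure hμ n i j hij hj, ?_, ?_, ?_, ?_, ?_⟩
  · intro s μ hs hμ k c hk X hX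
    have hr : 0 < ((c : ℝ) + 1) * μ := by positivity
    have := isProbabilityMeasure_sexpMeasure s hμ
    have hlaw := hX.hasLaw_repTaskTime (map_orderStat_one_sexp s hμ c)
    simp only [repLatency_eq hk, repCost_eq hk]
    constructor
    · convert (hasSecondMoment_codLatency_sexp (s := s) hr hk le_rfl).comp_hasLaw
        (by fun_prop) hlaw using 1
      simp [harmonicTwo]
      ring
    -- At `n = k` the terms with `n - k` vanish; scaling by `(c + 1) ^ 2` cancels one factor `c + 1`
    -- of the rate in the cross term.
    · convert ((hasSecondMoment_codCost_sexp (s := s) hr hk le_rfl).comp_hasLaw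
        (by fun_prop) hlaw).const_mul ((c : ℝ) + 1) using 1
      field_simp
      ring
  · intro s μ hs hμ k n hk hkn X hX
    exact ⟨(hasSecondMoment_codLatency_sexp hμ hk hkn).comp_hasLaw (by fun_prop)
        hX.hasLaw_sampleMeasure,
      (hasSecondMoment_codCost_sexp hμ hk hkn).comp_hasLaw (by fun_prop)
        hX.hasLaw_sampleMeasure⟩
  · intro s α hs n i j hi hij hj hα
    obtain ⟨h1, h2⟩ := max_lt_iff.1 hα
    have hi' : 0 < (n : ℝ) - i + 1 := by
      have : (i : ℝ) ≤ n := by exact_mod_cast hij.trans hj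
      linarith
    have hj' : 0 < (n : ℝ) - j + 1 := by
      have : (j : ℝ) ≤ n := by exact_mod_cast hj
      linarith
    -- Positivity of `α` is not assumed; it follows from `2 / (n - i + 1) < α`.
    exact jointMoment_paretoMeasure hs (lt_trans (by positivity) h1) n i j hi hij hj
      ((div_lt_iff₀' hi').1 h1) ((div_lt_iff₀' hj').1 h2)
  · intro s α hs hα k c hk X hX
    have hr : 0 < ((c : ℝ) + 1) * α := by positivity
    have := isProbabilityMeasure_paretoMeasure hs hα
    have := isProbabilityMeasure_paretoMeasure hs hr
    have hlaw := hX.hasLaw_repTaskTime (map_orderStat_one_pareto hs hα c)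
    simp only [repLatency_eq hk, repCost_eq hk]
    refine ⟨hasSecondMomentE_codLatency.comp_hasLaw (by fun_prop) hlaw, ?_, fun h2 => ⟨?_, ?_⟩⟩
    -- With `n = k` the first two terms vanish even if the moments are infinite, since `0 * ∞ = 0`.
    · have h := ((hasSecondMomentE_codCost (ae_paretoMeasure_nonneg hs _) hk le_rfl).comp_hasLaw
        (by fun_prop) hlaw).natCast_mul (c + 1)
      simpa using h
    · exact (hasSecondMoment_codLatency (integrable_orderStat_pareto hs hr le_rfl (by simpa using h2)
        hk le_rfl le_rfl)).comp_hasLaw (by fun_prop) hlaw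
    · have h := ((hasSecondMoment_codCost hk le_rfl fun i j hi hij hj =>
        integrable_orderStat_pareto hs hr le_rfl (by simpa using h2) hi hij hj).comp_hasLaw
          (by fun_prop) hlaw).const_mul ((c : ℝ) + 1)
      simpa using h
  · intro s α hs hα k n hk hkn X hX
    have := isProbabilityMeasure_paretoMeasure hs hα
    have hlaw := hX.hasLaw_sampleMeasure
    exact ⟨hasSecondMomentE_codLatency.comp_hasLaw (by fun_prop) hlaw,
      (hasSecondMomentE_codCost (ae_paretoMeasure_nonneg hs _) hk hkn).comp_hasLaw
        (by fun_prop) hlaw,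
      fun h2 => ⟨(hasSecondMoment_codLatency (integrable_orderStat_pareto hs hα hkn h2
          hk le_rfl le_rfl)).comp_hasLaw (by fun_prop) hlaw,
        (hasSecondMoment_codCost hk hkn fun i j hi hij hj =>
          integrable_orderStat_pareto hs hα hkn h2 hi hij hj).comp_hasLaw (by fun_prop) hlaw⟩⟩
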